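/- **Theorem (Ruelle–Perron–Frobenius theorem on $\mathbb R^{\mathbb N}$).** Equip $\mathbb R^{\mathbb N}$ with the metric $d(x,y)=\sum_{n\ge 1}\frac{1}{\pi 2^n}|\arctan x_n-\arctan y_n|$ (which induces the product topology) and let $\alpha>0$. A function $A:\mathbb R^{\mathbb N}\to\mathbb R$ is $\alpha$-Hölder if $|A(x)-A(y)|\le C\,d(x,y)^\alpha$ for some constant $C$ and all $x,y$; such a function is bounded and continuous. Let $f:\mathbb R\to\mathbb R$ be continuous and strictly positive with $\int_{\mathbb R} f(a)\,da=1$, and let $\nu=f\,dx$. For an $\alpha$-Hölder potential $A$ put $$\mathcal L_A\varphi(x)=\int_{\mathbb R}e^{A(ax)}\varphi(ax)f(a)\,da,\qquad ax=(a,x_1,x_2,\dots),$$ for bounded continuous $\varphi$, and write $\mathcal L_A^*\mu=\mu'$, for finite Borel measures $\mu,\mu'$ on $\mathbb R^{\mathbb N}$, if $\int\varphi\,d\mu'=\int\mathcal L_A\varphi\,d\mu$ for all real bounded continuous $\varphi$. Let $\sigma(x_1,x_2,\dots)=(x_2,x_3,\dots)$. Let $A$ be $\alpha$-Hölder. Then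 there are $\lambda_A>0$, a strictly positive $\alpha$-Hölder function $\psi_A:\mathbb R^{\mathbb N}\to\mathbb R$ and Borel probability measures $\mu_A,\rho_A$ on $\mathbb R^{\mathbb N}$ such that: a) $\mathcal L_A\psi_A=\lambda_A\psi_A$ on $\mathbb R^{\mathbb N}$. The eigenvalue $\lambda_A$ is simple (its generalized eigenspace is one-dimensional) on the space of real, and also of complex, bounded continuous functions, and it is leading: it equals the spectral radius of $\mathcal L_A$ on the space of complex bounded continuous functions. b) The potential $\bar A=A+\log\psi_A-\log(\psi_A\circ\sigma)-\log\lambda_A$ is $\alpha$-Hölder, $\mu_A$ is $\sigma$-invariant, $\mathcal L_{\bar A}^*\mu_A=\mu_A$, and $\mu_A$ is the only Borel probability measure $\mu$ with $\mathcal L_{\bar A}^*\mu=\mu$ (the Gibbs state). c) $d\rho_A=\psi_A^{-1}\,d\mu_A$ and $\mathcal L_A^*\rho_A=\lambda_A\rho_A$ (the conformal measure). d) For every $\alpha$-Hölder function $w:\mathbb R^{\mathbb N}\to\mathbb R$, as $n\to\infty$, uniformly on $\mathbb R^{\mathbb N}$, $$\mathcal L_{\bar A}^n w\to\int w\,d\mu_A,\qquad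 \lambda_A^{-n}\mathcal L_A^n w\to\psi_A\int w\,d\rho_A .$$ -/

import Mathlib

open MeasureTheory Filter Topology BoundedContinuousFunction

/-- The space `ℝ^ℕ` of real sequences, with the product topology and its Borel sigma-algebra. The
coordinates `x_1, x_2, …` are indexed here as `x 0, x 1, …`. -/
abbrev RSeq : Type := ℕ → ℝ

/-- The metric `d(x, y) = ∑_{n ≥ 1} |arctan x_n - arctan y_n| / (π 2^n)` on `ℝ^ℕ`. -/
noncomputable def seqDist (x y : RSeq) : ℝ :=
  ∑' n : ℕ, 1 / (Real.pi * 2 ^ (n + 1)) * |Real.arctan (x n) - Real.arctan (y n)|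

/-- `A : ℝ^ℕ → ℝ` is `α`-Hölder continuous with respect to the metric `seqDist`. -/
def IsHolder (α : ℝ) (A : RSeq → ℝ) : Prop :=
  ∃ C : ℝ, ∀ x y : RSeq, |A x - A y| ≤ C * seqDist x y ^ α

/-- The sequence `ax = (a, x_1, x_2, …)`. -/
def seqCons (a : ℝ) (x : RSeq) : RSeq
  | 0 => a
  | n + 1 => x n

/-- The shift `σ(x_1, x_2, x_3, …) = (x_2, x_3, …)`. -/
def seqShift (x : RSeq) : RSeq := fun n => x (n + 1)

/-- A strictly positive continuous function `f : ℝ → ℝ` with `∫ f(a) da = 1`. -/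
structure PosDensity where
  toFun : ℝ → ℝ
  continuous_toFun : Continuous toFun
  pos : ∀ a, 0 < toFun a
  integral_eq_one : ∫ a, toFun a = 1

/-- The a priori measure `ν = f dx`. -/
noncomputable def PosDensity.measure (f : PosDensity) : Measure ℝ :=
  volume.withDensity fun a => ENNReal.ofReal (f.toFun a)

instance PosDensity.isProbabilityMeasure (f : PosDensity) : IsProbabilityMeasure f.measure := by
  have hint : Integrable f.toFun := by
    by_contra h
    have := f.integral_eq_one
    rw [integral_undef h] at this
    exact zero_ne_one this
  constructor
  rw [PosDensity.measure, withDensity_apply _ MeasurableSet.univ, Measure.restrict_univ,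
    ← ofReal_integral_eq_lintegral_ofReal hint (ae_of_all _ fun a => (f.pos a).le),
    f.integral_eq_one, ENNReal.ofReal_one]

/-- The Ruelle operator `(L_A φ)(x) = ∫ e^{A(ax)} φ(ax) dν(a)`, for real or complex valued `φ`. -/
noncomputable def ruelle {𝕜 : Type*} [RCLike 𝕜] (ν : Measure ℝ) (A : RSeq → ℝ) (φ : RSeq → 𝕜)
    (x : RSeq) : 𝕜 :=
  ∫ a, Real.exp (A (seqCons a x)) • φ (seqCons a x) ∂ν

/-- The relation `L_A^* μ = μ'` between Borel measures on `ℝ^ℕ`: `∫ φ dμ' = ∫ L_A φ dμ` for all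
bounded continuous `φ`. -/
def IsRuelleDual (ν : Measure ℝ) (A : RSeq → ℝ) (μ μ' : Measure RSeq) : Prop :=
  ∀ φ : RSeq →ᵇ ℝ, ∫ x, φ x ∂μ' = ∫ x, ruelle ν A φ x ∂μ

/-- `Ā = A + log ψ - log (ψ ∘ σ) - log c`. -/
noncomputable def normalizedPotential (A ψ : RSeq → ℝ) (c : ℝ) (x : RSeq) : ℝ :=
  A x + Real.log (ψ x) - Real.log (ψ (seqShift x)) - Real.log c

/-! ### The Ruelle operator as a bounded operator on bounded continuous functions -/

lemma continuous_seqCons : Continuous fun p : ℝ × RSeq => seqCons p.1 p.2 := by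
  refine continuous_pi fun n => ?_
  cases n with
  | zero => exact continuous_fst
  | succ n => exact (continuous_apply n).comp continuous_snd

lemma seqDist_term_le (x y : RSeq) (n : ℕ) :
    1 / (Real.pi * 2 ^ (n + 1)) * |Real.arctan (x n) - Real.arctan (y n)| ≤
      1 / 2 * (1 / 2) ^ n := by
  have h : |Real.arctan (x n) - Real.arctan (y n)| ≤ Real.pi := by
    rw [abs_le]
    constructor <;>
    linarith [Real.arctan_lt_pi_div_two (x n), Real.neg_pi_div_two_lt_arctan (x n),
      Real.arctan_lt_pi_div_two (y n), Real.neg_pi_div_two_lt_arctan (y n)]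
  calc _ ≤ 1 / (Real.pi * 2 ^ (n + 1)) * Real.pi := by gcongr
    _ = 1 / 2 * (1 / 2) ^ n := by
      have := Real.pi_ne_zero
      rw [pow_succ, one_div_pow]
      field_simp

lemma seqDist_term_nonneg (x y : RSeq) (n : ℕ) :
    0 ≤ 1 / (Real.pi * 2 ^ (n + 1)) * |Real.arctan (x n) - Real.arctan (y n)| := by
  positivity

lemma summable_half : Summable fun n : ℕ => (1 / 2 : ℝ) * (1 / 2) ^ n :=
  summable_geometric_two.mul_left _

lemma seqDist_nonneg (x y : RSeq) : 0 ≤ seqDist x y := tsum_nonneg (seqDist_term_nonneg x y)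

lemma seqDist_le_one (x y : RSeq) : seqDist x y ≤ 1 := by
  have h := (Summable.of_nonneg_of_le (seqDist_term_nonneg x y) (seqDist_term_le x y)
    summable_half).tsum_le_tsum (seqDist_term_le x y) summable_half
  rw [tsum_mul_left, tsum_geometric_two] at h
  unfold seqDist
  linarith

lemma continuous_seqDist (x : RSeq) : Continuous fun y => seqDist x y := by
  refine continuous_tsum (fun n => ?_) summable_half fun n y => ?_
  · have := Real.continuous_arctan.comp (continuous_apply (A := fun _ : ℕ => ℝ) n)
    exact continuous_const.mul (continuous_const.sub this).abs
  · rw [Real.norm_of_nonneg (seqDist_term_nonneg x y n)]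
    exact seqDist_term_le x y n

lemma seqDist_self (x : RSeq) : seqDist x x = 0 := by simp [seqDist]

lemma IsHolder.continuous {α : ℝ} (hα : 0 < α) {A : RSeq → ℝ} (hA : IsHolder α A) :
    Continuous A := by
  obtain ⟨C, hC⟩ := hA
  rw [continuous_iff_continuousAt]
  intro x
  have h1 : Tendsto (fun y => C * seqDist x y ^ α) (𝓝 x) (𝓝 0) := by
    have h2 : Tendsto (fun y => C * seqDist x y ^ α) (𝓝 x) (𝓝 (C * seqDist x x ^ α)) :=
      (((continuous_seqDist x).rpow_const fun _ => Or.inr hα.le).const_mul C).tendsto x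
    rwa [seqDist_self, Real.zero_rpow hα.ne', mul_zero] at h2
  refine tendsto_iff_dist_tendsto_zero.2
    (squeeze_zero (fun _ => dist_nonneg) (fun y => ?_) h1)
  rw [dist_comm, Real.dist_eq]
  exact hC x y

/-- A Hölder continuous function as a bounded continuous function. -/
noncomputable def IsHolder.toBCF {α : ℝ} (hα : 0 < α) {A : RSeq → ℝ} (hA : IsHolder α A) :
    RSeq →ᵇ ℝ :=
  BoundedContinuousFunction.mkOfBound ⟨A, hA.continuous hα⟩ |hA.choose| fun x y =>
    (hA.choose_spec x y).trans <| by
      have h1 : seqDist x y ^ α ≤ 1 :=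
        Real.rpow_le_one (seqDist_nonneg x y) (seqDist_le_one x y) hα.le
      have h0 : 0 ≤ seqDist x y ^ α := Real.rpow_nonneg (seqDist_nonneg x y) α
      calc hA.choose * seqDist x y ^ α ≤ |hA.choose| * seqDist x y ^ α := by
            gcongr; exact le_abs_self _
        _ ≤ |hA.choose| * 1 := by gcongr
        _ = _ := mul_one _

lemma norm_ruelle_integrand_le {𝕜 : Type*} [RCLike 𝕜] (A : RSeq →ᵇ ℝ) (φ : RSeq →ᵇ 𝕜)
    (x : RSeq) : ‖Real.exp (A x) • φ x‖ ≤ Real.exp ‖A‖ * ‖φ‖ := by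
  rw [norm_smul, Real.norm_of_nonneg (Real.exp_pos _).le]
  gcongr
  · exact (le_abs_self _).trans (A.norm_coe_le_norm x)
  · exact φ.norm_coe_le_norm x

lemma continuous_ruelle_integrand {𝕜 : Type*} [RCLike 𝕜] (A : RSeq →ᵇ ℝ) (φ : RSeq →ᵇ 𝕜) :
    Continuous fun p : ℝ × RSeq =>
      Real.exp (A (seqCons p.1 p.2)) • φ (seqCons p.1 p.2) :=
  (Real.continuous_exp.comp (A.continuous.comp continuous_seqCons)).smul
    (φ.continuous.comp continuous_seqCons)

lemma integrable_ruelle_integrand {𝕜 : Type*} [RCLike 𝕜] (ν : Measure ℝ) [IsFiniteMeasure ν]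
    (A : RSeq →ᵇ ℝ) (φ : RSeq →ᵇ 𝕜) (x : RSeq) :
    Integrable (fun a => Real.exp (A (seqCons a x)) • φ (seqCons a x)) ν :=
  Integrable.of_bound (((continuous_ruelle_integrand A φ).comp
    (Continuous.prodMk_left x)).aestronglyMeasurable) (Real.exp ‖A‖ * ‖φ‖)
    (ae_of_all _ fun _ => norm_ruelle_integrand_le A φ _)

lemma continuous_ruelle {𝕜 : Type*} [RCLike 𝕜] (ν : Measure ℝ) [IsFiniteMeasure ν]
    (A : RSeq →ᵇ ℝ) (φ : RSeq →ᵇ 𝕜) : Continuous (ruelle ν A φ) :=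
  continuous_of_dominated (fun x => (integrable_ruelle_integrand ν A φ x).aestronglyMeasurable)
    (fun _ => ae_of_all _ fun _ => norm_ruelle_integrand_le A φ _)
    (integrable_const (Real.exp ‖A‖ * ‖φ‖))
    (ae_of_all _ fun a => (continuous_ruelle_integrand A φ).comp (Continuous.prodMk_right a))

lemma norm_ruelle_le {𝕜 : Type*} [RCLike 𝕜] (ν : Measure ℝ) [IsFiniteMeasure ν]
    (A : RSeq →ᵇ ℝ) (φ : RSeq →ᵇ 𝕜) (x : RSeq) :
    ‖ruelle ν A φ x‖ ≤ Real.exp ‖A‖ * ν.real Set.univ * ‖φ‖ := by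
  refine (norm_integral_le_of_norm_le_const
    (ae_of_all _ fun _ => norm_ruelle_integrand_le A φ _)).trans_eq ?_
  ring

/-- The Ruelle operator `L_A` as a bounded linear operator on the space of bounded continuous
functions on `ℝ^ℕ` with values in `𝕜 = ℝ` or `ℂ`. -/
noncomputable def ruelleCLM (𝕜 : Type*) [RCLike 𝕜] (ν : Measure ℝ) [IsFiniteMeasure ν]
    (A : RSeq →ᵇ ℝ) : (RSeq →ᵇ 𝕜) →L[𝕜] (RSeq →ᵇ 𝕜) :=
  LinearMap.mkContinuous
    { toFun := fun φ => BoundedContinuousFunction.ofNormedAddCommGroup (ruelle ν A φ)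
        (continuous_ruelle ν A φ) _ (norm_ruelle_le ν A φ)
      map_add' := fun φ χ => by
        ext x
        have := integral_add (integrable_ruelle_integrand ν A φ x)
          (integrable_ruelle_integrand ν A χ x)
        simpa [ruelle, smul_add] using this
      map_smul' := fun c φ => by
        ext x
        have := integral_smul (μ := ν) c
          (fun a => Real.exp (A (seqCons a x)) • φ (seqCons a x))
        simpa [ruelle, mul_left_comm, smul_eq_mul] using this }
    (Real.exp ‖A‖ * ν.real Set.univ)
    fun φ => (BoundedContinuousFunction.norm_le (by positivity)).2 (norm_ruelle_le ν A φ)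

@[simp] lemma IsHolder.toBCF_apply {α : ℝ} (hα : 0 < α) {A : RSeq → ℝ} (hA : IsHolder α A)
    (x : RSeq) : hA.toBCF hα x = A x := rfl

@[simp] lemma ruelleCLM_apply {𝕜 : Type*} [RCLike 𝕜] (ν : Measure ℝ) [IsFiniteMeasure ν]
    (A : RSeq →ᵇ ℝ) (φ : RSeq →ᵇ 𝕜) (x : RSeq) : ruelleCLM 𝕜 ν A φ x = ruelle ν A φ x := rfl

/-! ### The metric and Hölder functions -/

/-! Prepending a common coordinate halves the distance, and the space has diameter at most one.
Consider the cone of nonnegative `φ` with `φ x ≤ exp (K d(x, y) ^ α) φ y`. Averaging over preimages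
contracts the exponent, so for large `K` the operator `L` maps the cone of constant `K` into that of
constant `K - 1` (`exists_cone_mapsTo`). Bounded diameter gives a Harnack inequality, `φ x ≤ exp K *
φ y`. Together these yield a hands-on Birkhoff contraction: if `a h ≤ f ≤ b h` in the cone order,
each application of `L` improves the bounds so that `b - a` shrinks by a fixed factor `r < 1`
(`exists_cone_contraction`). The underlying space is not compact, so geometric convergence and
completeness of the bounded continuous functions stand in for compactness arguments.

With `h = 1` and `f = L 1`, the ratios `L ^ (n + 1) 1 / L ^ n 1` are pinched geometrically. The
iterates normalized at one point therefore converge to a positive eigenfunction `ψ`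
(`exists_eigenfunction`). Multiplication by `ψ` conjugates `lam⁻¹ L` to the operator of the
normalized potential, which fixes `1`. For that operator, the contraction with `h = 1` and `f = w`
sends every Hölder `w` to a constant under iteration (`exists_tendsto_pow_const`).

That constant has to be an integral. Iterating the dual operator on a point mass gives probability
measures whose marginals are dominated uniformly in the number of steps; they are tight, and any
limit point represents the constants. Hölder functions of exponent at most one determine measures,
so the limit point is unique, invariant and independent of the starting point (`exists_gibbs`). A
continuous fixed function takes at `x` the value of its integral against the limit measure started
at `x`, so it is constant. Hence the eigenspace is one-dimensional. The bound `‖L ^ n‖ ≤ C * lam ^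
n`, obtained by comparison with `ψ`, rules out Jordan blocks and bounds the spectral radius. -/

lemma summable_seqDist (x y : RSeq) : Summable fun n : ℕ =>
    1 / (Real.pi * 2 ^ (n + 1)) * |Real.arctan (x n) - Real.arctan (y n)| :=
  Summable.of_nonneg_of_le (seqDist_term_nonneg x y) (seqDist_term_le x y) summable_half

lemma seqDist_comm (x y : RSeq) : seqDist x y = seqDist y x := by
  simp only [seqDist, abs_sub_comm]

/-- The common first coordinate contributes nothing and all other weights are halved. This is the
only source of contraction. -/
lemma seqDist_seqCons (a : ℝ) (x y : RSeq) :
    seqDist (seqCons a x) (seqCons a y) = 1 / 2 * seqDist x y := by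
  rw [seqDist, (summable_seqDist _ _).tsum_eq_zero_add, seqDist, ← tsum_mul_left]
  simp only [seqCons, sub_self, abs_zero, mul_zero, zero_add]
  refine tsum_congr fun n => ?_
  have := Real.pi_ne_zero
  rw [pow_succ _ (n + 1)]
  field_simp

lemma seqDist_seqShift_le (x y : RSeq) :
    seqDist (seqShift x) (seqShift y) ≤ 2 * seqDist x y := by
  have h := (summable_seqDist x y).tsum_eq_zero_add
  have h0 := seqDist_term_nonneg x y 0
  have h1 : seqDist (seqShift x) (seqShift y) = 2 * ∑' n : ℕ,
      1 / (Real.pi * 2 ^ (n + 1 + 1)) * |Real.arctan (x (n + 1)) - Real.arctan (y (n + 1))| := by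
    rw [seqDist, ← tsum_mul_left]
    refine tsum_congr fun n => ?_
    have := Real.pi_ne_zero
    rw [pow_succ _ (n + 1)]
    simp only [seqShift]
    field_simp
  rw [h1]
  unfold seqDist
  linarith

lemma abs_arctan_sub_arctan_le (x y : RSeq) (n : ℕ) :
    |Real.arctan (x n) - Real.arctan (y n)| ≤ Real.pi * 2 ^ (n + 1) * seqDist x y := by
  have h := (summable_seqDist x y).le_tsum n fun m _ => seqDist_term_nonneg x y m
  have hp : 0 < Real.pi * 2 ^ (n + 1) := by positivity
  rw [one_div, inv_mul_le_iff₀ hp] at h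
  exact h

lemma seqDist_rpow_nonneg (α : ℝ) (x y : RSeq) : 0 ≤ seqDist x y ^ α :=
  Real.rpow_nonneg (seqDist_nonneg x y) α

lemma seqDist_rpow_le_one {α : ℝ} (hα : 0 < α) (x y : RSeq) : seqDist x y ^ α ≤ 1 :=
  Real.rpow_le_one (seqDist_nonneg x y) (seqDist_le_one x y) hα.le

lemma seqDist_seqCons_rpow (α a : ℝ) (x y : RSeq) :
    seqDist (seqCons a x) (seqCons a y) ^ α = (1 / 2) ^ α * seqDist x y ^ α := by
  rw [seqDist_seqCons, Real.mul_rpow (by norm_num) (seqDist_nonneg x y)]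

/-! ### Stability properties of Hölder functions -/

namespace IsHolder

variable {α : ℝ} {A B : RSeq → ℝ}

lemma exists_nonneg (hA : IsHolder α A) :
    ∃ C, 0 ≤ C ∧ ∀ x y : RSeq, |A x - A y| ≤ C * seqDist x y ^ α := by
  obtain ⟨C, hC⟩ := hA
  refine ⟨|C|, abs_nonneg C, fun x y => (hC x y).trans ?_⟩
  exact mul_le_mul_of_nonneg_right (le_abs_self C) (seqDist_rpow_nonneg α x y)

lemma exists_abs_le (hα : 0 < α) (hA : IsHolder α A) : ∃ M, ∀ x, |A x| ≤ M :=
  ⟨‖hA.toBCF hα‖, fun x => (hA.toBCF hα).norm_coe_le_norm x⟩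

lemma const (α c : ℝ) : IsHolder α fun _ => c := ⟨0, fun x y => by simp⟩

lemma add (hA : IsHolder α A) (hB : IsHolder α B) : IsHolder α fun x => A x + B x := by
  obtain ⟨C, hC⟩ := hA
  obtain ⟨D, hD⟩ := hB
  refine ⟨C + D, fun x y => ?_⟩
  rw [add_mul, add_sub_add_comm]
  exact (abs_add_le _ _).trans (add_le_add (hC x y) (hD x y))

/-- Composition with a function that is Lipschitz on the range. -/
lemma comp_lipschitz (hA : IsHolder α A) {g : ℝ → ℝ} {K : ℝ} (hK : 0 ≤ K)
    (hg : ∀ x y, |g (A x) - g (A y)| ≤ K * |A x - A y|) : IsHolder α fun x => g (A x) := by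
  obtain ⟨C, hC⟩ := hA
  refine ⟨K * C, fun x y => (hg x y).trans ?_⟩
  rw [mul_assoc]
  exact mul_le_mul_of_nonneg_left (hC x y) hK

lemma const_mul (hA : IsHolder α A) (c : ℝ) : IsHolder α fun x => c * A x :=
  hA.comp_lipschitz (g := fun s => c * s) (abs_nonneg c) fun x y => by rw [← mul_sub, abs_mul]

lemma sub (hA : IsHolder α A) (hB : IsHolder α B) : IsHolder α fun x => A x - B x := by
  simpa [sub_eq_add_neg] using hA.add (hB.const_mul (-1))

lemma mul (hα : 0 < α) (hA : IsHolder α A) (hB : IsHolder α B) :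
    IsHolder α fun x => A x * B x := by
  obtain ⟨M, hM⟩ := hA.exists_abs_le hα
  obtain ⟨N, hN⟩ := hB.exists_abs_le hα
  obtain ⟨C, hC0, hC⟩ := hA.exists_nonneg
  obtain ⟨D, hD0, hD⟩ := hB.exists_nonneg
  refine ⟨M * D + C * N, fun x y => ?_⟩
  have h0 := seqDist_rpow_nonneg α x y
  calc |A x * B x - A y * B y| = |A x * (B x - B y) + (A x - A y) * B y| := by ring_nf
    _ ≤ |A x| * |B x - B y| + |A x - A y| * |B y| := by
      rw [← abs_mul, ← abs_mul]; exact abs_add_le _ _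
    _ ≤ M * (D * seqDist x y ^ α) + C * seqDist x y ^ α * N :=
      add_le_add (mul_le_mul (hM x) (hD x y) (abs_nonneg _) ((abs_nonneg _).trans (hM x)))
        (mul_le_mul (hC x y) (hN y) (abs_nonneg _) (by positivity))
    _ = _ := by ring

lemma log {m : ℝ} (hm : 0 < m) (hA : IsHolder α A) (hmA : ∀ x, m ≤ A x) :
    IsHolder α fun x => Real.log (A x) := by
  have key : ∀ x y, Real.log (A x) - Real.log (A y) ≤ m⁻¹ * |A x - A y| := fun x y => by
    have hx := hm.trans_le (hmA x)
    have hy := hm.trans_le (hmA y)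
    rw [← Real.log_div hx.ne' hy.ne']
    calc Real.log (A x / A y) ≤ A x / A y - 1 := Real.log_le_sub_one_of_pos (div_pos hx hy)
      _ = (A y)⁻¹ * (A x - A y) := by field_simp
      _ ≤ (A y)⁻¹ * |A x - A y| := by gcongr; exact le_abs_self _
      _ ≤ m⁻¹ * |A x - A y| := by gcongr; exact hmA y
  refine hA.comp_lipschitz (g := Real.log) (K := m⁻¹) (by positivity) fun x y => ?_
  rw [abs_le]
  constructor
  · have := key y x
    rw [abs_sub_comm] at this
    linarith
  · exact key x y

lemma inv {m : ℝ} (hm : 0 < m) (hA : IsHolder α A) (hmA : ∀ x, m ≤ A x) :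
    IsHolder α fun x => (A x)⁻¹ := by
  refine hA.comp_lipschitz (g := fun s => s⁻¹) (K := m⁻¹ * m⁻¹) (by positivity) fun x y => ?_
  have hx := hm.trans_le (hmA x)
  have hy := hm.trans_le (hmA y)
  rw [inv_sub_inv hx.ne' hy.ne', abs_div, abs_mul, abs_of_pos hx, abs_of_pos hy, abs_sub_comm,
    div_eq_inv_mul, mul_inv]
  gcongr
  · exact hmA x
  · exact hmA y

lemma comp_seqShift (hα : 0 < α) (hA : IsHolder α A) : IsHolder α fun x => A (seqShift x) := by
  obtain ⟨C, hC0, hC⟩ := hA.exists_nonneg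
  refine ⟨C * 2 ^ α, fun x y => (hC _ _).trans ?_⟩
  rw [mul_assoc, ← Real.mul_rpow (by norm_num) (seqDist_nonneg x y)]
  have := seqDist_nonneg (seqShift x) (seqShift y)
  gcongr
  exact seqDist_seqShift_le x y

lemma mono_exponent {β : ℝ} (hβ : 0 < β) (h : β ≤ α) (hA : IsHolder α A) : IsHolder β A := by
  obtain ⟨C, hC0, hC⟩ := hA.exists_nonneg
  refine ⟨C, fun x y => (hC x y).trans (mul_le_mul_of_nonneg_left ?_ hC0)⟩
  exact Real.rpow_le_rpow_of_exponent_ge' (seqDist_nonneg x y) (seqDist_le_one x y) hβ.le h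

/-- These functions separate points. They are Lipschitz for `seqDist`, hence the restriction `β ≤
1`. -/
lemma arctan_apply {β : ℝ} (hβ : 0 < β) (h : β ≤ 1) (n : ℕ) :
    IsHolder β fun x => Real.arctan (x n) :=
  mono_exponent hβ h ⟨_, fun x y => by
    rw [Real.rpow_one]; exact abs_arctan_sub_arctan_le x y n⟩

lemma normalizedPotential (hα : 0 < α) (hA : IsHolder α A) {ψ : RSeq → ℝ} (hψ : IsHolder α ψ)
    {m : ℝ} (hm : 0 < m) (hmψ : ∀ x, m ≤ ψ x) (c : ℝ) :
    IsHolder α (normalizedPotential A ψ c) :=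
  ((hA.add (hψ.log hm hmψ)).sub ((hψ.log hm hmψ).comp_seqShift hα)).sub (.const α _)

end IsHolder

/-! ### Cones of log-Hölder functions -/

/-- The cone of nonnegative functions with `φ x ≤ exp (K d(x, y) ^ α) φ y`. -/
def HolderCone (α K : ℝ) (φ : RSeq →ᵇ ℝ) : Prop :=
  (∀ x, 0 ≤ φ x) ∧ ∀ x y, φ x ≤ Real.exp (K * seqDist x y ^ α) * φ y

namespace HolderCone

variable {α K K' : ℝ} {φ : RSeq →ᵇ ℝ}

lemma smul (h : HolderCone α K φ) {c : ℝ} (hc : 0 ≤ c) : HolderCone α K (c • φ) := by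
  refine ⟨fun x => mul_nonneg hc (h.1 x), fun x y => ?_⟩
  calc c * φ x ≤ c * (Real.exp (K * seqDist x y ^ α) * φ y) :=
        mul_le_mul_of_nonneg_left (h.2 x y) hc
    _ = Real.exp (K * seqDist x y ^ α) * (c * φ y) := by ring

lemma mono (hK : K ≤ K') (h : HolderCone α K φ) : HolderCone α K' φ := by
  refine ⟨h.1, fun x y => (h.2 x y).trans ?_⟩
  have := seqDist_rpow_nonneg α x y
  have := h.1 y
  gcongr

lemma one (hK : 0 ≤ K) : HolderCone α K 1 := by
  refine ⟨fun x => zero_le_one, fun x y => ?_⟩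
  have := seqDist_rpow_nonneg α x y
  simp only [BoundedContinuousFunction.coe_one, Pi.one_apply, mul_one]
  exact Real.one_le_exp (by positivity)

/-- Harnack inequality: the diameter is at most one, so the exponent never exceeds `K`. -/
lemma apply_le (hα : 0 < α) (hK : 0 ≤ K) (h : HolderCone α K φ) (x y : RSeq) :
    φ x ≤ Real.exp K * φ y := by
  refine (h.2 x y).trans ?_
  have := h.1 y
  gcongr
  exact mul_le_of_le_one_right hK (seqDist_rpow_le_one hα x y)

lemma isHolder (hα : 0 < α) (hK : 0 ≤ K) (h : HolderCone α K φ) : IsHolder α φ := by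
  have key : ∀ x y, φ x - φ y ≤ ‖φ‖ * (K * Real.exp K) * seqDist x y ^ α := fun x y => by
    set t := seqDist x y ^ α
    have ht0 : 0 ≤ t := seqDist_rpow_nonneg α x y
    have ht1 : t ≤ 1 := seqDist_rpow_le_one hα x y
    -- Multiplying `1 - s ≤ exp (-s)` by `exp s` gives `exp s - 1 ≤ s * exp s`, applied to `s = K *
    -- t ≤ K`.
    have h1 : Real.exp (K * t) - 1 ≤ K * t * Real.exp K := by
      have h2 : 1 - K * t ≤ Real.exp (-(K * t)) := by
        linarith [Real.add_one_le_exp (-(K * t))]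
      have h3 : Real.exp (K * t) ≤ Real.exp K :=
        Real.exp_le_exp.2 (mul_le_of_le_one_right hK ht1)
      have h4 : Real.exp (-(K * t)) * Real.exp (K * t) = 1 := by
        rw [← Real.exp_add]; simp
      have h5 : 0 ≤ K * t := by positivity
      nlinarith [Real.exp_pos (K * t)]
    have h6 := h.1 y
    have h7 : φ y ≤ ‖φ‖ := (le_abs_self _).trans (φ.norm_coe_le_norm y)
    calc φ x - φ y ≤ φ y * (Real.exp (K * t) - 1) := by linarith [h.2 x y]
      _ ≤ φ y * (K * t * Real.exp K) := by gcongr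
      _ ≤ ‖φ‖ * (K * t * Real.exp K) := by gcongr
      _ = _ := by ring
  refine ⟨‖φ‖ * (K * Real.exp K), fun x y => abs_le.2 ⟨?_, key x y⟩⟩
  have := key y x
  rw [seqDist_comm] at this
  linarith

end HolderCone

/-- Keeps the limit of the normalized iterates in the cone, which makes the eigenfunction Hölder and
bounded below. -/
lemma isClosed_holderCone (α K : ℝ) : IsClosed {φ : RSeq →ᵇ ℝ | HolderCone α K φ} := by
  have hc : ∀ x, Continuous fun φ : RSeq →ᵇ ℝ => φ x := fun x =>
    continuous_eval_const x
  simp only [HolderCone, Set.ofPred_and, Set.ofPred_forall]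
  exact (isClosed_iInter fun x => isClosed_le continuous_const (hc x)).inter
    (isClosed_iInter fun x => isClosed_iInter fun y =>
      isClosed_le (hc x) (continuous_const.mul (hc y)))

/-- A Hölder function becomes a member of the cone after adding a large constant. -/
lemma holderCone_add_const {α K H M : ℝ} (hK : 0 < K) (hH : 0 ≤ H) {w : RSeq →ᵇ ℝ}
    (hw : ∀ x y, |w x - w y| ≤ H * seqDist x y ^ α) (hM : ‖w‖ + H / K ≤ M) :
    HolderCone α K (w + M • 1) := by
  -- With this lower bound the additive error `H t` is at most `K t (w y + M)`, a relative error
  -- covered by `1 + K t ≤ exp (K t)`.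
  have hb : ∀ x, H / K ≤ w x + M := fun x => by
    linarith [(abs_le.1 (w.norm_coe_le_norm x)).1]
  have hap : ∀ x, (w + M • (1 : RSeq →ᵇ ℝ)) x = w x + M := fun x => by simp
  refine ⟨fun x => ?_, fun x y => ?_⟩
  · rw [hap]; exact (div_nonneg hH hK.le).trans (hb x)
  · rw [hap, hap]
    have h0 := seqDist_rpow_nonneg α x y
    have h1 := Real.add_one_le_exp (K * seqDist x y ^ α)
    have h2 := (abs_le.1 (hw x y)).2
    have h3 := hb y
    have h4 : 0 ≤ w y + M := (div_nonneg hH hK.le).trans h3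
    rw [div_le_iff₀ hK] at h3
    calc w x + M ≤ (w y + M) + H * seqDist x y ^ α := by linarith
      _ ≤ (w y + M) + (w y + M) * K * seqDist x y ^ α := by gcongr
      _ = (K * seqDist x y ^ α + 1) * (w y + M) := by ring
      _ ≤ _ := by gcongr

/-- A multiple of a dominated member of a smaller cone can be subtracted. -/
lemma exists_holderCone_sub {α K K' : ℝ} (hα : 0 < α) (hK' : 0 ≤ K') (hK : K' < K) :
    ∃ δ : ℝ, 0 < δ ∧ δ ≤ 1 ∧ ∀ g h : RSeq →ᵇ ℝ, HolderCone α K' g → HolderCone α K' h →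
      (∀ x, h x ≤ g x) → HolderCone α K (g - δ • h) := by
  have hs : 0 < K + K' := by linarith
  -- Since `h ≤ g`, the cone inequality for `g - δ h` reduces to `δ (exp (K t) - exp (-K' t)) ≤ exp
  -- (K t) - exp (K' t)` for `t` in `[0, 1]`. The right side is at least `(K - K') t` and the
  -- bracket on the left at most `(K + K') t exp (K + K')`; `δ` is the quotient.
  refine ⟨(K - K') / ((K + K') * Real.exp (K + K')), div_pos (by linarith) (by positivity), ?_,
    fun g h hg hh hle => ?_⟩
  · rw [div_le_one (by positivity)]
    have := Real.one_le_exp hs.le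
    nlinarith
  set δ := (K - K') / ((K + K') * Real.exp (K + K')) with hδ
  have hδ0 : 0 < δ := div_pos (by linarith) (by positivity)
  have hδ1 : δ ≤ 1 := by
    rw [hδ, div_le_one (by positivity)]
    have := Real.one_le_exp hs.le
    nlinarith
  refine ⟨fun x => ?_, fun x y => ?_⟩
  · have := mul_le_mul_of_nonneg_right hδ1 (hh.1 x)
    have := hle x
    simp only [BoundedContinuousFunction.coe_sub, BoundedContinuousFunction.coe_smul, Pi.sub_apply,
      smul_eq_mul]
    linarith
  · simp only [BoundedContinuousFunction.coe_sub, BoundedContinuousFunction.coe_smul, Pi.sub_apply,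
      smul_eq_mul]
    have hgx := hg.2 x y
    have hhy := hh.2 y x
    rw [seqDist_comm] at hhy
    set t := seqDist x y ^ α
    have ht0 : 0 ≤ t := seqDist_rpow_nonneg α x y
    have ht1 : t ≤ 1 := seqDist_rpow_le_one hα x y
    have e0 : Real.exp (-(K' * t)) * Real.exp (K' * t) = 1 := by rw [← Real.exp_add]; simp
    have hhx : Real.exp (-(K' * t)) * h y ≤ h x := by
      calc _ ≤ Real.exp (-(K' * t)) * (Real.exp (K' * t) * h x) := by gcongr
        _ = h x := by rw [← mul_assoc, e0, one_mul]
    have e1 : (K - K') * t ≤ Real.exp (K * t) - Real.exp (K' * t) := by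
      have h1 : Real.exp (K * t) = Real.exp (K' * t) * Real.exp ((K - K') * t) := by
        rw [← Real.exp_add]; ring_nf
      have h2 := Real.add_one_le_exp ((K - K') * t)
      have h3 : 1 ≤ Real.exp (K' * t) := Real.one_le_exp (by positivity)
      have h4 : 0 ≤ (K - K') * t := mul_nonneg (by linarith) ht0
      rw [h1]
      nlinarith
    have e2 : Real.exp (K * t) - Real.exp (-(K' * t)) ≤ (K + K') * t * Real.exp (K + K') := by
      have h1 : Real.exp (-(K' * t)) = Real.exp (K * t) * Real.exp (-((K + K') * t)) := by
        rw [← Real.exp_add]; ring_nf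
      have h2 := Real.add_one_le_exp (-((K + K') * t))
      have h3 : Real.exp (K * t) ≤ Real.exp (K + K') := Real.exp_le_exp.2 (by nlinarith)
      have h4 : 0 ≤ (K + K') * t := by positivity
      have h5 := Real.exp_pos (K * t)
      rw [h1]
      nlinarith
    have e3 : δ * (Real.exp (K * t) - Real.exp (-(K' * t))) ≤
        Real.exp (K * t) - Real.exp (K' * t) := by
      refine (mul_le_mul_of_nonneg_left e2 hδ0.le).trans (le_trans (le_of_eq ?_) e1)
      rw [hδ]
      field_simp
    have hy := hh.1 y
    have hgy := hg.1 y
    have e4 : 0 ≤ Real.exp (K * t) - Real.exp (K' * t) :=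
      sub_nonneg.2 (Real.exp_le_exp.2 (by nlinarith))
    have e5 := mul_le_mul_of_nonneg_right e3 hy
    have e6 := mul_le_mul_of_nonneg_left (hle y) e4
    have e7 := mul_le_mul_of_nonneg_left hhx hδ0.le
    nlinarith

/-! ### The Ruelle operator contracts the cones -/

section Contraction

variable {ν : Measure ℝ} [IsProbabilityMeasure ν] {A : RSeq →ᵇ ℝ}

lemma ruelleCLM_mono {φ χ : RSeq →ᵇ ℝ} (h : ∀ x, φ x ≤ χ x) (x : RSeq) :
    ruelleCLM ℝ ν A φ x ≤ ruelleCLM ℝ ν A χ x :=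
  integral_mono (integrable_ruelle_integrand ν A φ x) (integrable_ruelle_integrand ν A χ x)
    fun _ => mul_le_mul_of_nonneg_left (h _) (Real.exp_pos _).le

lemma ruelleCLM_one_ge (x : RSeq) : Real.exp (-‖A‖) ≤ ruelleCLM ℝ ν A 1 x := by
  have h : ∫ _, Real.exp (-‖A‖) ∂ν ≤
      ∫ a, Real.exp (A (seqCons a x)) • (1 : RSeq →ᵇ ℝ) (seqCons a x) ∂ν :=
    integral_mono (integrable_const _) (integrable_ruelle_integrand ν A 1 x) fun a => by
      simp only [BoundedContinuousFunction.coe_one, Pi.one_apply, smul_eq_mul, mul_one]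
      exact Real.exp_le_exp.2 (abs_le.1 (A.norm_coe_le_norm _)).1
  simpa [ruelle] using h

/-- For each `a`, passing from `ax` to `ay` costs exponent `C` for the weight and `K` for `φ`, both
at half the distance. -/
lemma HolderCone.ruelleCLM {α K C : ℝ}
    (hA : ∀ x y, |A x - A y| ≤ C * seqDist x y ^ α) {φ : RSeq →ᵇ ℝ} (hφ : HolderCone α K φ) :
    HolderCone α ((1 / 2) ^ α * (K + C)) (ruelleCLM ℝ ν A φ) := by
  refine ⟨fun x => integral_nonneg fun a => mul_nonneg (Real.exp_pos _).le (hφ.1 _),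
    fun x y => ?_⟩
  rw [ruelleCLM_apply, ruelleCLM_apply, ruelle, ruelle, ← integral_const_mul]
  refine integral_mono (integrable_ruelle_integrand ν A φ x)
    ((integrable_ruelle_integrand ν A φ y).const_mul _) fun a => ?_
  have h1 := hφ.2 (seqCons a x) (seqCons a y)
  have h2 := (abs_le.1 (hA (seqCons a x) (seqCons a y))).2
  rw [seqDist_seqCons_rpow] at h1 h2
  have h3 : Real.exp (A (seqCons a x)) ≤
      Real.exp (C * ((1 / 2) ^ α * seqDist x y ^ α)) * Real.exp (A (seqCons a y)) := by
    rw [← Real.exp_add]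
    exact Real.exp_le_exp.2 (by linarith)
  have h4 := hφ.1 (seqCons a x)
  simp only [smul_eq_mul]
  calc _ ≤ (Real.exp (C * ((1 / 2) ^ α * seqDist x y ^ α)) * Real.exp (A (seqCons a y))) *
        (Real.exp (K * ((1 / 2) ^ α * seqDist x y ^ α)) * φ (seqCons a y)) := by gcongr
    _ = _ := by
      rw [show (1 / 2) ^ α * (K + C) * seqDist x y ^ α =
        C * ((1 / 2) ^ α * seqDist x y ^ α) + K * ((1 / 2) ^ α * seqDist x y ^ α) by ring,
        Real.exp_add]
      ring

variable (ν) in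
lemma exists_cone_mapsTo {α C : ℝ} (hα : 0 < α) (hC : 0 ≤ C)
    (hA : ∀ x y, |A x - A y| ≤ C * seqDist x y ^ α) :
    ∃ K : ℝ, 1 ≤ K ∧ ∀ φ, HolderCone α K φ → HolderCone α (K - 1) (ruelleCLM ℝ ν A φ) := by
  have h0 : (0 : ℝ) < (1 / 2) ^ α := by positivity
  have h1 : ((1 : ℝ) / 2) ^ α < 1 := Real.rpow_lt_one (by norm_num) (by norm_num) hα
  set θ : ℝ := (1 / 2) ^ α with hθ
  have h2 : 0 < 1 - θ := by linarith
  -- The solution of `θ * (K + C) = K - 1`. The gain of one is the room needed to subtract a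
  -- multiple of another cone element.
  refine ⟨(θ * C + 1) / (1 - θ), ?_, fun φ hφ => ?_⟩
  · rw [le_div_iff₀ h2]
    have := mul_nonneg h0.le hC
    linarith
  · have := hφ.ruelleCLM (ν := ν) hA
    rw [← hθ] at this
    convert this using 1
    field_simp
    ring

/-- The gaps `f - a h` and `b h - f` add up to `(b - a) h`, so one of them is at least half of it at
the point `0`, hence by Harnack a definite fraction of it everywhere. After applying `L`, a fixed
multiple of `(b - a) L h` can be subtracted from that gap inside the cone. -/
lemma exists_cone_contraction_step {α K : ℝ} (hα : 0 < α) (hK : 1 ≤ K)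
    (hL : ∀ φ, HolderCone α K φ → HolderCone α (K - 1) (ruelleCLM ℝ ν A φ)) :
    ∃ r : ℝ, 0 ≤ r ∧ r < 1 ∧ ∀ (f h : RSeq →ᵇ ℝ) (a b : ℝ), a ≤ b → HolderCone α K h →
      HolderCone α K (f - a • h) → HolderCone α K (b • h - f) →
      ∃ a' b' : ℝ, a ≤ a' ∧ b' ≤ b ∧ b' - a' = r * (b - a) ∧
        HolderCone α K (ruelleCLM ℝ ν A f - a' • ruelleCLM ℝ ν A h) ∧
        HolderCone α K (b' • ruelleCLM ℝ ν A h - ruelleCLM ℝ ν A f) := by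
  obtain ⟨δ, hδ0, hδ1, hδ⟩ := exists_holderCone_sub hα (sub_nonneg.2 hK) (sub_one_lt K)
  have hK0 : 0 ≤ K := zero_le_one.trans hK
  -- Two uses of Harnack, for `u` and for `h`, cost `exp (2 * K)`; the `2` comes from choosing the
  -- larger gap at `0`.
  set κ := Real.exp (-(2 * K)) / 2 with hκ
  have hκ0 : 0 < κ := by positivity
  have hκ1 : κ ≤ 1 / 2 := by
    have : Real.exp (-(2 * K)) ≤ 1 := Real.exp_le_one_iff.2 (by linarith)
    linarith
  have hδκ : δ * κ ≤ 1 / 2 := by nlinarith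
  set L := ruelleCLM ℝ ν A with hLdef
  have key : ∀ (u h : RSeq →ᵇ ℝ) (s : ℝ), 0 ≤ s → HolderCone α K h → HolderCone α K u →
      s * h 0 ≤ 2 * u 0 → HolderCone α K (L u - (δ * κ * s) • L h) := by
    intro u h s hs hh hu h0
    have hle : ∀ x, (κ * s) • h x ≤ u x := fun x => by
      have h1 := hu.apply_le hα hK0 0 x
      have h2 := hh.apply_le hα hK0 x 0
      have e : Real.exp (-(2 * K)) * (Real.exp K * Real.exp K) = 1 := by
        rw [← Real.exp_add, ← Real.exp_add, show -(2 * K) + (K + K) = 0 by ring, Real.exp_zero]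
      calc (κ * s) * h x ≤ (κ * s) * (Real.exp K * h 0) := by gcongr
        _ = κ * Real.exp K * (s * h 0) := by ring
        _ ≤ κ * Real.exp K * (2 * u 0) := by gcongr
        _ ≤ κ * Real.exp K * (2 * (Real.exp K * u x)) := by gcongr
        _ = Real.exp (-(2 * K)) * (Real.exp K * Real.exp K) * u x := by rw [hκ]; ring
        _ = u x := by rw [e, one_mul]
    -- The subtraction happens after applying `L` because both images lie in the smaller cone of
    -- constant `K - 1`.
    have := hδ (L u) (L ((κ * s) • h)) (hL _ hu) (hL _ (hh.smul (by positivity)))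
      (ruelleCLM_mono hle)
    rwa [map_smul, smul_smul, ← mul_assoc] at this
  have hup : ∀ φ, HolderCone α K φ → HolderCone α K (L φ) := fun φ hφ =>
    (hL φ hφ).mono (by linarith)
  refine ⟨1 - δ * κ, by linarith, by nlinarith [mul_pos hδ0 hκ0], fun f h a b hab hh hu hv => ?_⟩
  have hs : 0 ≤ b - a := sub_nonneg.2 hab
  have hδs : 0 ≤ δ * κ * (b - a) := by positivity
  have hLu := hup _ hu
  have hLv := hup _ hv
  -- If the lower gap is large at `0` the lower bound is raised, otherwise the upper bound is
  -- reduced.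
  by_cases hc : (b - a) * h 0 ≤ 2 * (f - a • h) 0
  · refine ⟨a + δ * κ * (b - a), b, by linarith, le_rfl, by ring, ?_, ?_⟩
    · have := key _ h _ hs hh hu hc
      rw [map_sub, map_smul] at this
      convert this using 1
      module
    · rwa [map_sub, map_smul] at hLv
  · have hc' : (b - a) * h 0 ≤ 2 * (b • h - f) 0 := by
      simp only [BoundedContinuousFunction.coe_sub, BoundedContinuousFunction.coe_smul,
        Pi.sub_apply, smul_eq_mul] at hc ⊢
      linarith
    refine ⟨a, b - δ * κ * (b - a), le_rfl, by linarith, by ring, ?_, ?_⟩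
    · rwa [map_sub, map_smul] at hLu
    · have := key _ h _ hs hh hv hc'
      rw [map_sub, map_smul] at this
      convert this using 1
      module

lemma exists_cone_contraction {α K : ℝ} (hα : 0 < α) (hK : 1 ≤ K)
    (hL : ∀ φ, HolderCone α K φ → HolderCone α (K - 1) (ruelleCLM ℝ ν A φ)) :
    ∃ r : ℝ, 0 ≤ r ∧ r < 1 ∧ ∀ (f h : RSeq →ᵇ ℝ) (a b : ℝ), a ≤ b → HolderCone α K h →
      HolderCone α K (f - a • h) → HolderCone α K (b • h - f) → ∀ n : ℕ,
      ∃ a' b' : ℝ, a ≤ a' ∧ b' ≤ b ∧ b' - a' = r ^ n * (b - a) ∧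
        HolderCone α K ((ruelleCLM ℝ ν A ^ n) h) ∧
        HolderCone α K ((ruelleCLM ℝ ν A ^ n) f - a' • (ruelleCLM ℝ ν A ^ n) h) ∧
        HolderCone α K (b' • (ruelleCLM ℝ ν A ^ n) h - (ruelleCLM ℝ ν A ^ n) f) := by
  obtain ⟨r, hr0, hr1, hr⟩ := exists_cone_contraction_step hα hK hL
  refine ⟨r, hr0, hr1, fun f h a b hab hh hu hv n => ?_⟩
  induction n with
  | zero => exact ⟨a, b, le_rfl, le_rfl, by simp, hh, hu, hv⟩
  | succ n ih =>
    obtain ⟨a', b', ha, hb, hba, hh', hu', hv'⟩ := ih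
    have hab' : a' ≤ b' := by
      have : 0 ≤ r ^ n * (b - a) := mul_nonneg (pow_nonneg hr0 n) (sub_nonneg.2 hab)
      linarith
    obtain ⟨a'', b'', ha', hb', hba', hu'', hv''⟩ := hr _ _ a' b' hab' hh' hu' hv'
    simp only [pow_succ', mul_apply_eq_comp]
    exact ⟨a'', b'', ha.trans ha', hb'.trans hb, by rw [hba', hba]; ring,
      (hL _ hh').mono (by linarith), hu'', hv''⟩

/-! ### The eigenfunction and convergence for normalized potentials -/

lemma exists_tendsto_of_dist_le_geometric {r D : ℝ} (hr : r < 1) {u : ℕ → RSeq →ᵇ ℝ}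
    (h : ∀ n x, |u (n + 1) x - u n x| ≤ D * r ^ n) (hD : ∀ n, 0 ≤ D * r ^ n) :
    ∃ v, Tendsto u atTop (𝓝 v) := by
  refine cauchySeq_tendsto_of_complete (cauchySeq_of_le_geometric r D hr fun n => ?_)
  rw [dist_comm]
  exact (BoundedContinuousFunction.dist_le (hD n)).2 fun x => h n x

/-- Existence of a positive Hölder eigenfunction. -/
theorem exists_eigenfunction {α C : ℝ} (hα : 0 < α) (hC : 0 ≤ C)
    (hA : ∀ x y, |A x - A y| ≤ C * seqDist x y ^ α) :
    ∃ (lam : ℝ) (ψ : RSeq →ᵇ ℝ) (m : ℝ), 0 < lam ∧ 0 < m ∧ (∀ x, m ≤ ψ x) ∧ IsHolder α ψ ∧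
      ruelleCLM ℝ ν A ψ = lam • ψ := by
  obtain ⟨K, hK, hL⟩ := exists_cone_mapsTo ν hα hC hA
  have hK0 : 0 ≤ K := zero_le_one.trans hK
  have hK1 : 0 ≤ K - 1 := sub_nonneg.2 hK
  obtain ⟨r, hr0, hr1, hr⟩ := exists_cone_contraction hα hK hL
  obtain ⟨δ, hδ0, hδ1, hδ⟩ := exists_holderCone_sub hα hK1 (sub_one_lt K)
  set L := ruelleCLM ℝ ν A with hLdef
  set m₀ := Real.exp (-‖A‖)
  have hm₀ : 0 < m₀ := Real.exp_pos _
  have hone : HolderCone α (K - 1) 1 := HolderCone.one hK1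
  have hL1 : HolderCone α (K - 1) (L 1) := hL 1 (HolderCone.one hK0)
  have hge : ∀ x, m₀ ≤ L 1 x := fun x => ruelleCLM_one_ge x
  have hle : ∀ x, L 1 x ≤ ‖L 1‖ := fun x => (le_abs_self _).trans ((L 1).norm_coe_le_norm x)
  have hM0 : m₀ ≤ ‖L 1‖ := (hge 0).trans (hle 0)
  -- The pointwise bounds `m₀ ≤ L 1 ≤ ‖L 1‖` become bounds in the cone order at the price of a
  -- factor `δ`, since `1` and `L 1` lie in the smaller cone.
  have hu : HolderCone α K (L 1 - (δ * m₀) • 1) := by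
    have := hδ (L 1) (m₀ • 1) hL1 (hone.smul hm₀.le) fun x => by simpa using hge x
    rwa [smul_smul] at this
  have hv : HolderCone α K ((‖L 1‖ / δ) • 1 - L 1) := by
    have := (hδ (‖L 1‖ • 1) (L 1) (hone.smul (norm_nonneg _)) hL1
      fun x => by simpa using hle x).smul (inv_nonneg.2 hδ0.le)
    rwa [smul_sub, smul_smul, smul_smul, inv_mul_cancel₀ hδ0.ne', one_smul, inv_mul_eq_div] at this
  have hab : δ * m₀ ≤ ‖L 1‖ / δ := by
    rw [le_div_iff₀ hδ0]
    nlinarith [mul_le_of_le_one_left hm₀.le hδ1]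
  -- Since `(L ^ n) (L 1) = (L ^ (n + 1)) 1`, this compares consecutive iterates of `1`. The lower
  -- bounds never fall below `a₀ > 0`.
  have main := hr (L 1) 1 _ _ hab (HolderCone.one hK0) hu hv
  set a₀ := δ * m₀ with ha₀
  have ha₀pos : 0 < a₀ := mul_pos hδ0 hm₀
  set D := ‖L 1‖ / δ - a₀
  have hcone : ∀ n, HolderCone α K ((L ^ n) 1) := fun n => (main n).choose_spec.choose_spec.2.2.2.1
  have hsucc : ∀ n φ, (L ^ n) (L φ) = (L ^ (n + 1)) φ := fun n φ => by
    rw [pow_succ, mul_apply_eq_comp]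
  have hpos : ∀ n x, 0 < (L ^ n) 1 x := by
    intro n
    induction n with
    | zero => intro x; simp
    | succ n ih =>
      intro x
      obtain ⟨a, b, ha, -, -, -, h, -⟩ := main n
      have h1 := h.1 x
      rw [hsucc] at h1
      simp only [BoundedContinuousFunction.coe_sub, BoundedContinuousFunction.coe_smul,
        Pi.sub_apply, smul_eq_mul] at h1
      nlinarith [ih x]
  set p : ℕ → RSeq →ᵇ ℝ := fun n => ((L ^ n) 1 0)⁻¹ • (L ^ n) 1 with hp
  have hpcone : ∀ n, HolderCone α K (p n) := fun n => (hcone n).smul (inv_nonneg.2 (hpos n 0).le)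
  have hp0 : ∀ n, p n 0 = 1 := fun n => inv_mul_cancel₀ (hpos n 0).ne'
  have hpx : ∀ n x, p n x ≤ Real.exp K := fun n x => by
    have := (hpcone n).apply_le hα hK0 x 0
    rwa [hp0, mul_one] at this
  have hdiff : ∀ n x, |p (n + 1) x - p n x| ≤ Real.exp K * D / a₀ * r ^ n := by
    intro n x
    obtain ⟨a, b, ha, -, hba, -, h, h'⟩ := main n
    have h1 : ∀ y, a * (L ^ n) 1 y ≤ (L ^ (n + 1)) 1 y := fun y => by
      have := h.1 y
      rw [hsucc] at this
      exact sub_nonneg.1 this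
    have h2 : ∀ y, (L ^ (n + 1)) 1 y ≤ b * (L ^ n) 1 y := fun y => by
      have := h'.1 y
      rw [hsucc] at this
      exact sub_nonneg.1 this
    have hapos : 0 < a := ha₀pos.trans_le ha
    set q := (L ^ n) (1 : RSeq →ᵇ ℝ)
    set q' := (L ^ (n + 1)) (1 : RSeq →ᵇ ℝ)
    have q0 : 0 < q 0 := hpos n 0
    have q0' : 0 < q' 0 := hpos (n + 1) 0
    have qx : 0 < q x := hpos n x
    -- The increment is controlled by the ratio `q' / q` at `x` and at `0`, both in `[a, b]`.
    have e1 : p (n + 1) x - p n x = (q' x / q x - q' 0 / q 0) / (q' 0 / q 0) * p n x := by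
      change (q' 0)⁻¹ * q' x - (q 0)⁻¹ * q x = _ / _ * ((q 0)⁻¹ * q x)
      field_simp
    have i1 : a ≤ q' x / q x := (le_div_iff₀ qx).2 (h1 x)
    have i2 : q' x / q x ≤ b := (div_le_iff₀ qx).2 (h2 x)
    have i3 : a ≤ q' 0 / q 0 := (le_div_iff₀ q0).2 (h1 0)
    have i4 : q' 0 / q 0 ≤ b := (div_le_iff₀ q0).2 (h2 0)
    have i5 : |q' x / q x - q' 0 / q 0| ≤ b - a := abs_le.2 ⟨by linarith, by linarith⟩
    rw [e1, abs_mul, abs_div, abs_of_pos (div_pos q0' q0), abs_of_nonneg ((hpcone n).1 x)]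
    calc _ ≤ (b - a) / a₀ * Real.exp K := by
          refine mul_le_mul (div_le_div₀ ((abs_nonneg _).trans i5) i5 ha₀pos (ha.trans i3))
            (hpx n x) ((hpcone n).1 x) (div_nonneg ((abs_nonneg _).trans i5) ha₀pos.le)
      _ = _ := by rw [hba]; ring
  obtain ⟨ψ, hψ⟩ := exists_tendsto_of_dist_le_geometric hr1 hdiff fun n =>
    mul_nonneg (div_nonneg (mul_nonneg (Real.exp_pos _).le (sub_nonneg.2 hab)) ha₀pos.le)
      (pow_nonneg hr0 n)
  have heval : ∀ x, Tendsto (fun n => p n x) atTop (𝓝 (ψ x)) := fun x =>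
    ((continuous_eval_const x).tendsto ψ).comp hψ
  have hψcone : HolderCone α K ψ :=
    (isClosed_holderCone α K).mem_of_tendsto hψ (Eventually.of_forall hpcone)
  have hψ0 : ψ 0 = 1 := tendsto_nhds_unique (heval 0) (by simp [hp0])
  have hψm : ∀ x, Real.exp (-K) ≤ ψ x := fun x => by
    have := hψcone.apply_le hα hK0 0 x
    rw [hψ0, ← mul_le_mul_iff_of_pos_left (Real.exp_pos (-K)), mul_one, ← mul_assoc,
      ← Real.exp_add, neg_add_cancel, Real.exp_zero, one_mul] at this
    exact this
  -- The normalization at `0` identifies the scalar; in the limit this is the eigenvalue equation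
  -- with eigenvalue `L ψ 0`.
  have hLp : ∀ n, L (p n) = (L (p n) 0) • p (n + 1) := fun n => by
    have e : L (p n) = ((L ^ n) 1 0)⁻¹ • (L ^ (n + 1)) 1 := by
      rw [hp, map_smul, pow_succ', mul_apply_eq_comp]
    have h0 := (hpos (n + 1) 0).ne'
    rw [e]
    simp only [hp, smul_smul, BoundedContinuousFunction.coe_smul, smul_eq_mul]
    rw [mul_assoc, mul_inv_cancel₀ h0, mul_one]
  have hLψ : Tendsto (fun n => L (p n)) atTop (𝓝 (L ψ)) := (L.continuous.tendsto ψ).comp hψ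
  have hlim : L ψ = (L ψ 0) • ψ := by
    refine tendsto_nhds_unique hLψ ?_
    have h1 : Tendsto (fun n => L (p n) 0) atTop (𝓝 (L ψ 0)) :=
      ((continuous_eval_const (0 : RSeq)).tendsto (L ψ)).comp hLψ
    have h2 := h1.smul (hψ.comp (tendsto_add_atTop_nat 1))
    exact h2.congr fun n => (hLp n).symm
  refine ⟨L ψ 0, ψ, Real.exp (-K), ?_, Real.exp_pos _, hψm, hψcone.isHolder hα hK0, hlim⟩
  have h1 := ruelleCLM_mono (ν := ν) (A := A) (φ := Real.exp (-K) • 1) (χ := ψ)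
    (fun x => by simpa using hψm x) 0
  rw [map_smul] at h1
  exact (mul_pos (Real.exp_pos _) (hm₀.trans_le (hge 0))).trans_le h1

/-- For a normalized Hölder potential, the iterates on Hölder functions converge to constants. -/
theorem exists_tendsto_pow_const {α C : ℝ} (hα : 0 < α) (hC : 0 ≤ C)
    (hA : ∀ x y, |A x - A y| ≤ C * seqDist x y ^ α) (h1 : ruelleCLM ℝ ν A 1 = 1)
    {w : RSeq →ᵇ ℝ} (hw : IsHolder α w) :
    ∃ c : ℝ, Tendsto (fun n => (ruelleCLM ℝ ν A ^ n) w) atTop (𝓝 (c • 1)) := by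
  obtain ⟨K, hK, hL⟩ := exists_cone_mapsTo ν hα hC hA
  have hK0 : 0 ≤ K := zero_le_one.trans hK
  obtain ⟨r, hr0, hr1, hr⟩ := exists_cone_contraction hα hK hL
  obtain ⟨H, hH0, hH⟩ := hw.exists_nonneg
  set L := ruelleCLM ℝ ν A with hLdef
  have hpow : ∀ n, (L ^ n) (1 : RSeq →ᵇ ℝ) = 1 := by
    intro n
    induction n with
    | zero => simp
    | succ n ih => rw [pow_succ, mul_apply_eq_comp, h1, ih]
  set M := ‖w‖ + H / K
  have hM0 : 0 ≤ M := add_nonneg (norm_nonneg w) (div_nonneg hH0 hK0)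
  have hK1 : 0 < K := zero_lt_one.trans_le hK
  -- Both `w + M` and `M - w` lie in the cone, giving initial bounds `-M` and `M` relative to the
  -- fixed function `1`.
  have hu : HolderCone α K (w - (-M) • 1) := by
    have := holderCone_add_const (M := M) hK1 hH0 hH le_rfl
    convert this using 1
    module
  have hv : HolderCone α K (M • 1 - w) := by
    have := holderCone_add_const (w := -w) (M := M) hK1 hH0 (fun x y => by
      simpa [neg_add_eq_sub, abs_sub_comm] using hH x y) (by rw [norm_neg])
    rwa [neg_add_eq_sub] at this
  have main := hr w 1 _ _ (by linarith) (HolderCone.one hK0) hu hv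
  simp only [hpow] at main
  have hbd : ∀ n, ∃ a b : ℝ, b - a = r ^ n * (M - -M) ∧
      (∀ x, a ≤ (L ^ n) w x) ∧ ∀ x, (L ^ n) w x ≤ b := fun n => by
    obtain ⟨a, b, -, -, hba, -, h, h'⟩ := main n
    exact ⟨a, b, hba, fun x => by simpa using h.1 x, fun x => by simpa using h'.1 x⟩
  have hdiff : ∀ n x, |(L ^ (n + 1)) w x - (L ^ n) w x| ≤ (M - -M) * r ^ n := by
    intro n x
    obtain ⟨a, b, hba, ha, hb⟩ := hbd n
    -- `L` preserves order and fixes constants, so `(L ^ (n + 1)) w` also takes values in `[a, b]`.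
    have i1 := ruelleCLM_mono (ν := ν) (A := A) (φ := a • 1) (χ := (L ^ n) w)
      (fun x => by simpa using ha x) x
    have i2 := ruelleCLM_mono (ν := ν) (A := A) (χ := b • 1) (φ := (L ^ n) w)
      (fun x => by simpa using hb x) x
    rw [map_smul, h1] at i1 i2
    simp only [BoundedContinuousFunction.coe_smul, BoundedContinuousFunction.coe_one, Pi.one_apply,
      smul_eq_mul, mul_one] at i1 i2
    rw [pow_succ', mul_apply_eq_comp, mul_comm, ← hba]
    have := ha x
    have := hb x
    exact abs_le.2 ⟨by linarith, by linarith⟩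
  obtain ⟨v, hv⟩ := exists_tendsto_of_dist_le_geometric (u := fun n => (L ^ n) w) hr1 hdiff fun n =>
    mul_nonneg (by linarith) (pow_nonneg hr0 n)
  refine ⟨v 0, ?_⟩
  suffices h : v = (v 0) • 1 by rwa [← h]
  ext x
  have hevx := fun x : RSeq => ((continuous_eval_const x).tendsto v).comp hv
  have hlim : Tendsto (fun n => (M - -M) * r ^ n) atTop (𝓝 0) := by
    simpa using (tendsto_pow_atTop_nhds_zero_of_lt_one hr0 hr1).const_mul (M - -M)
  have h0 : |v x - v 0| ≤ 0 := by
    refine le_of_tendsto_of_tendsto ((hevx x).sub (hevx 0)).abs hlim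
      (Eventually.of_forall fun n => ?_)
    obtain ⟨a, b, hba, ha, hb⟩ := hbd n
    simp only [Function.comp_apply]
    rw [mul_comm, ← hba]
    have := ha x
    have := hb x
    have := ha 0
    have := hb 0
    exact abs_le.2 ⟨by linarith, by linarith⟩
  have := sub_eq_zero.1 (abs_nonpos_iff.1 h0)
  simpa using this

end Contraction

/-! ### The dual of the Ruelle operator on measures -/

/-- The image of a finite measure under the dual of the Ruelle operator. -/
noncomputable def dualRuelle (ν : Measure ℝ) (A : RSeq →ᵇ ℝ) (m : Measure RSeq) : Measure RSeq :=
  ((ν.prod m).withDensity fun q => ENNReal.ofReal (Real.exp (A (seqCons q.1 q.2)))).map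
    fun q => seqCons q.1 q.2

lemma continuous_seqShift : Continuous seqShift :=
  continuous_pi fun n => continuous_apply (n + 1)

lemma seqShift_seqCons (a : ℝ) (x : RSeq) : seqShift (seqCons a x) = x := rfl

section Dual

variable {ν : Measure ℝ} [IsProbabilityMeasure ν] {A : RSeq →ᵇ ℝ}

instance dualRuelle_isFinite (m : Measure RSeq) [IsFiniteMeasure m] :
    IsFiniteMeasure (dualRuelle ν A m) := by
  have : IsFiniteMeasure ((ν.prod m).withDensity
      fun q => ENNReal.ofReal (Real.exp (A (seqCons q.1 q.2)))) := by
    refine isFiniteMeasure_withDensity (ne_of_lt ?_)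
    calc _ ≤ ∫⁻ _, ENNReal.ofReal (Real.exp ‖A‖) ∂(ν.prod m) :=
          lintegral_mono fun q => ENNReal.ofReal_le_ofReal
            (Real.exp_le_exp.2 ((le_abs_self _).trans (A.norm_coe_le_norm _)))
      _ < ⊤ := by
          rw [lintegral_const]
          exact ENNReal.mul_lt_top ENNReal.ofReal_lt_top (measure_lt_top _ _)
  exact Measure.isFiniteMeasure_map _ _

lemma integral_dualRuelle (m : Measure RSeq) [IsFiniteMeasure m] (φ : RSeq →ᵇ ℝ) :
    ∫ x, φ x ∂(dualRuelle ν A m) = ∫ x, ruelleCLM ℝ ν A φ x ∂m := by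
  have hm : Measurable fun q : ℝ × RSeq => (Real.exp (A (seqCons q.1 q.2))).toNNReal :=
    ((Real.continuous_exp.comp (A.continuous.comp continuous_seqCons)).measurable).real_toNNReal
  rw [dualRuelle, integral_map continuous_seqCons.measurable.aemeasurable
    φ.continuous.aestronglyMeasurable]
  simp only [ENNReal.ofReal]
  rw [integral_withDensity_eq_integral_smul hm]
  have he : ∀ q : ℝ × RSeq, (Real.exp (A (seqCons q.1 q.2))).toNNReal • φ (seqCons q.1 q.2) =
      Real.exp (A (seqCons q.1 q.2)) • φ (seqCons q.1 q.2) := fun q => by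
    rw [NNReal.smul_def, Real.coe_toNNReal _ (Real.exp_pos _).le]
  simp only [he]
  rw [integral_prod_symm]
  · rfl
  · exact Integrable.of_bound (continuous_ruelle_integrand A φ).aestronglyMeasurable
      (Real.exp ‖A‖ * ‖φ‖) (ae_of_all _ fun _ => norm_ruelle_integrand_le A φ _)

lemma isProbabilityMeasure_dualRuelle (h1 : ruelleCLM ℝ ν A 1 = 1) (m : Measure RSeq)
    [IsProbabilityMeasure m] : IsProbabilityMeasure (dualRuelle ν A m) := by
  have h := integral_dualRuelle (ν := ν) (A := A) m 1
  rw [h1] at h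
  simp only [BoundedContinuousFunction.coe_one, Pi.one_apply, integral_const, smul_eq_mul, mul_one,
    probReal_univ] at h
  exact isProbabilityMeasure_iff_real.2 h

/-- As `σ (ax) = x`, the factor `φ (σ (ax))` leaves the integral, and `L 1 = 1` remains. -/
lemma ruelleCLM_comp_seqShift (h1 : ruelleCLM ℝ ν A 1 = 1) (φ : RSeq →ᵇ ℝ) :
    ruelleCLM ℝ ν A (φ.compContinuous ⟨seqShift, continuous_seqShift⟩) = φ := by
  ext x
  have h : ruelle ν A (1 : RSeq →ᵇ ℝ) x = 1 := by
    rw [← ruelleCLM_apply, h1]; rfl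
  simp only [ruelle, BoundedContinuousFunction.coe_one, Pi.one_apply] at h
  simp only [ruelleCLM_apply, ruelle, BoundedContinuousFunction.compContinuous_apply,
    ContinuousMap.coe_mk, seqShift_seqCons]
  rw [integral_smul_const]
  simp only [smul_eq_mul, mul_one] at h ⊢
  rw [h, one_mul]

/-- The dual form of `L (φ ∘ σ) = φ`. It gives invariance of fixed measures and transports marginal
bounds from one coordinate to the next. -/
lemma map_seqShift_dualRuelle (h1 : ruelleCLM ℝ ν A 1 = 1) (m : Measure RSeq)
    [IsFiniteMeasure m] : (dualRuelle ν A m).map seqShift = m := by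
  have : IsFiniteMeasure ((dualRuelle ν A m).map seqShift) := Measure.isFiniteMeasure_map _ _
  refine ext_of_forall_integral_eq_of_IsFiniteMeasure fun φ => ?_
  rw [integral_map continuous_seqShift.measurable.aemeasurable φ.continuous.aestronglyMeasurable]
  have := integral_dualRuelle (ν := ν) (A := A) m
    (φ.compContinuous ⟨seqShift, continuous_seqShift⟩)
  rwa [ruelleCLM_comp_seqShift h1] at this

omit [IsProbabilityMeasure ν] in
-- The new first coordinate is drawn from `ν` with a weight of at most `exp ‖A‖`.
lemma dualRuelle_zero_mem_le [SFinite ν] (m : Measure RSeq) [IsProbabilityMeasure m] {B : Set ℝ}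
    (hB : MeasurableSet B) :
    dualRuelle ν A m {x | x 0 ∈ B} ≤ ENNReal.ofReal (Real.exp ‖A‖) * ν B := by
  have hS : MeasurableSet {x : RSeq | x 0 ∈ B} := measurable_pi_apply 0 hB
  have hpre : (fun q : ℝ × RSeq => seqCons q.1 q.2) ⁻¹' {x : RSeq | x 0 ∈ B} =
      B ×ˢ Set.univ := by
    ext q
    simp [seqCons]
  rw [dualRuelle, Measure.map_apply continuous_seqCons.measurable hS, hpre,
    withDensity_apply _ (hB.prod .univ)]
  calc _ ≤ ∫⁻ _ in B ×ˢ Set.univ, ENNReal.ofReal (Real.exp ‖A‖) ∂(ν.prod m) :=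
        lintegral_mono fun q => ENNReal.ofReal_le_ofReal
          (Real.exp_le_exp.2 ((le_abs_self _).trans (A.norm_coe_le_norm _)))
    _ = _ := by rw [setLIntegral_const, Measure.prod_prod, measure_univ, mul_one]

lemma isProbabilityMeasure_iterate_dualRuelle (h1 : ruelleCLM ℝ ν A 1 = 1) (m : Measure RSeq)
    [IsProbabilityMeasure m] (n : ℕ) : IsProbabilityMeasure ((dualRuelle ν A)^[n] m) := by
  induction n with
  | zero => simpa
  | succ n ih =>
    rw [Function.iterate_succ_apply']
    exact isProbabilityMeasure_dualRuelle h1 _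

lemma integral_iterate_dualRuelle (h1 : ruelleCLM ℝ ν A 1 = 1) (m : Measure RSeq)
    [IsProbabilityMeasure m] (n : ℕ) (φ : RSeq →ᵇ ℝ) :
    ∫ x, φ x ∂((dualRuelle ν A)^[n] m) = ∫ x, (ruelleCLM ℝ ν A ^ n) φ x ∂m := by
  induction n generalizing φ with
  | zero => simp
  | succ n ih =>
    have := isProbabilityMeasure_iterate_dualRuelle h1 m n
    rw [Function.iterate_succ_apply', integral_dualRuelle, ih, pow_succ, mul_apply_eq_comp]

/-- Coordinate `k` after `n` steps was either inserted at one of the steps, or is an original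
coordinate of `m` of index at most `k`. The bound does not depend on `n`, which gives tightness. -/
lemma iterate_dualRuelle_apply_mem_le (h1 : ruelleCLM ℝ ν A 1 = 1) (m : Measure RSeq)
    [IsProbabilityMeasure m] (n k : ℕ) {B : Set ℝ} (hB : MeasurableSet B) :
    (dualRuelle ν A)^[n] m {x | x k ∈ B} ≤
      (ENNReal.ofReal (Real.exp ‖A‖) • ν + ∑ j ∈ Finset.range (k + 1), m.map fun x => x j) B := by
  have hS : ∀ k, MeasurableSet {x : RSeq | x k ∈ B} := fun k => measurable_pi_apply k hB
  induction n generalizing k with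
  | zero =>
    simp only [Function.iterate_zero, id_eq, Measure.add_apply, Measure.finsetSum_apply]
    refine le_trans ?_ (le_add_of_nonneg_left zero_le)
    refine le_trans (le_of_eq ?_)
      (Finset.single_le_sum (f := fun j => (m.map fun x : RSeq => x j) B)
        (fun _ _ => zero_le) (Finset.self_mem_range_succ k))
    rw [Measure.map_apply (measurable_pi_apply k) hB]
    rfl
  | succ n ih =>
    have := isProbabilityMeasure_iterate_dualRuelle h1 m n
    rw [Function.iterate_succ_apply']
    cases k with
    | zero =>
      refine (dualRuelle_zero_mem_le _ hB).trans ?_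
      rw [Measure.add_apply]
      exact le_add_of_nonneg_right zero_le
    | succ k =>
      have h := congrArg (fun μ : Measure RSeq => μ {x : RSeq | x k ∈ B})
        (map_seqShift_dualRuelle h1 ((dualRuelle ν A)^[n] m))
      simp only [Measure.map_apply continuous_seqShift.measurable (hS k)] at h
      have hp : seqShift ⁻¹' {x : RSeq | x k ∈ B} =
          {x : RSeq | x (k + 1) ∈ B} := rfl
      rw [hp] at h
      rw [h]
      refine (ih k).trans ?_
      rw [Finset.sum_range_succ _ (k + 1), ← add_assoc, Measure.add_apply _ (m.map _)]
      exact le_add_of_nonneg_right zero_le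

end Dual

/-- A family of measures on `ℝ^ℕ` whose marginals are dominated by finite measures is tight. -/
lemma isTightMeasureSet_of_marginal_le {S : Set (Measure RSeq)} (τ : ℕ → Measure ℝ)
    [∀ k, IsFiniteMeasure (τ k)]
    (h : ∀ μ ∈ S, ∀ k, ∀ B : Set ℝ, MeasurableSet B → μ {x | x k ∈ B} ≤ τ k B) :
    IsTightMeasureSet S := by
  rw [isTightMeasureSet_iff_exists_isCompact_measure_compl_le]
  intro ε hε
  -- The error is distributed over the coordinates; the product of the compact sets is compact by
  -- Tychonoff.
  obtain ⟨ε', hε', hsum⟩ := ENNReal.exists_pos_sum_of_countable' hε.ne' ℕ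
  have hK : ∀ k, ∃ K : Set ℝ, IsCompact K ∧ τ k Kᶜ ≤ ε' k := fun k => by
    obtain ⟨K, hK, hle⟩ := isTightMeasureSet_iff_exists_isCompact_measure_compl_le.1
      (isTightMeasureSet_singleton (μ := τ k)) (ε' k) (hε' k)
    exact ⟨K, hK, hle _ rfl⟩
  choose K hKc hKle using hK
  refine ⟨Set.pi Set.univ K, isCompact_univ_pi hKc, fun μ hμ => ?_⟩
  have hsub : (Set.pi Set.univ K)ᶜ ⊆ ⋃ k, {x : RSeq | x k ∈ (K k)ᶜ} := fun x hx => by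
    simpa [Set.mem_pi] using hx
  calc μ (Set.pi Set.univ K)ᶜ ≤ ∑' k, μ {x : RSeq | x k ∈ (K k)ᶜ} :=
        (measure_mono hsub).trans (measure_iUnion_le _)
    _ ≤ ∑' k, ε' k := ENNReal.tsum_le_tsum fun k =>
        (h μ hμ k _ (hKc k).measurableSet.compl).trans (hKle k)
    _ ≤ ε := hsum.le

/-- Hölder functions of exponent at most one determine finite measures. -/
lemma measure_ext_of_isHolder {β : ℝ} (hβ : 0 < β) (hβ1 : β ≤ 1) {μ μ' : Measure RSeq}
    [IsFiniteMeasure μ] [IsFiniteMeasure μ']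
    (h : ∀ w : RSeq →ᵇ ℝ, IsHolder β w → ∫ x, w x ∂μ = ∫ x, w x ∂μ') : μ = μ' := by
  -- Hölder functions form an algebra containing the constants and separating points, and such an
  -- algebra determines finite measures on a Polish space.
  let S : StarSubalgebra ℝ (RSeq →ᵇ ℝ) :=
    { carrier := {w | IsHolder β w}
      mul_mem' := fun ha hb => ha.mul hβ hb
      add_mem' := fun ha hb => ha.add hb
      algebraMap_mem' := fun c => IsHolder.const β c
      star_mem' := fun ha => ha }
  refine ext_of_forall_mem_subalgebra_integral_eq_of_polish (A := S) ?_ h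
  intro x y hxy
  obtain ⟨n, hn⟩ := Function.ne_iff.1 hxy
  have hH := IsHolder.arctan_apply hβ hβ1 n
  refine ⟨fun x => Real.arctan (x n), ⟨(hH.toBCF hβ).toContinuousMap, ?_, rfl⟩,
    fun he => hn (Real.arctan_injective he)⟩
  exact ⟨hH.toBCF hβ, hH, rfl⟩

/-! ### Existence and uniqueness of the Gibbs state -/

section Gibbs

variable {ν : Measure ℝ} [IsProbabilityMeasure ν] {A : RSeq →ᵇ ℝ}

/-- `w` is the difference of a cone element and a constant; `L` keeps both in a cone, and cone
elements are Hölder. -/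
lemma IsHolder.ruelleCLM {β : ℝ} (hβ : 0 < β) (hA : IsHolder β A) {w : RSeq →ᵇ ℝ}
    (hw : IsHolder β w) : IsHolder β (ruelleCLM ℝ ν A w) := by
  obtain ⟨C, hC0, hC⟩ := hA.exists_nonneg
  obtain ⟨H, hH0, hH⟩ := hw.exists_nonneg
  obtain ⟨K, hK, hL⟩ := exists_cone_mapsTo ν hβ hC0 hC
  have hK0 : 0 ≤ K - 1 := sub_nonneg.2 hK
  have h1 := (hL _ (holderCone_add_const (zero_lt_one.trans_le hK) hH0 hH le_rfl)).isHolder hβ hK0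
  have h2 := ((hL _ (HolderCone.one (zero_le_one.trans hK))).isHolder hβ hK0).const_mul
    (‖w‖ + H / K)
  have h3 := h1.sub h2
  rw [map_add, map_smul] at h3
  simpa using! h3

/-- A weak limit point of the iterates of the dual operator started at a point mass. -/
lemma exists_limit_measure {β : ℝ} (hβ : 0 < β) (hA : IsHolder β A)
    (h1 : ruelleCLM ℝ ν A 1 = 1) (x : RSeq) :
    ∃ μ : Measure RSeq, IsProbabilityMeasure μ ∧
      (∀ w : RSeq →ᵇ ℝ, IsHolder β w →
        Tendsto (fun n => (ruelleCLM ℝ ν A ^ n) w) atTop (𝓝 ((∫ y, w y ∂μ) • 1))) ∧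
      ∀ φ : RSeq →ᵇ ℝ, ruelleCLM ℝ ν A φ = φ → φ x = ∫ y, φ y ∂μ := by
  have hp := isProbabilityMeasure_iterate_dualRuelle h1 (Measure.dirac x)
  let u : ℕ → ProbabilityMeasure RSeq := fun n => ⟨(dualRuelle ν A)^[n] (Measure.dirac x), hp n⟩
  have htight : IsTightMeasureSet
      {((μ : ProbabilityMeasure RSeq) : Measure RSeq) | μ ∈ Set.range u} := by
    have hfin : IsFiniteMeasure (ENNReal.ofReal (Real.exp ‖A‖) • ν) :=
      Measure.smul_finite _ ENNReal.ofReal_ne_top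
    have hfin' : ∀ k, IsFiniteMeasure (ENNReal.ofReal (Real.exp ‖A‖) • ν +
        ∑ j ∈ Finset.range (k + 1), (Measure.dirac x).map fun y : RSeq => y j) := fun k => by
      infer_instance
    refine isTightMeasureSet_of_marginal_le (fun k => ENNReal.ofReal (Real.exp ‖A‖) • ν +
      ∑ j ∈ Finset.range (k + 1), (Measure.dirac x).map fun y : RSeq => y j) ?_
    rintro _ ⟨_, ⟨n, rfl⟩, rfl⟩ k B hB
    exact iterate_dualRuelle_apply_mem_le h1 _ n k hB
  obtain ⟨μ, -, hμ⟩ := (isCompact_closure_of_isTightMeasureSet htight).exists_mapClusterPt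
    (f := atTop) (u := u) (le_principal_iff.2 (mem_map.2 (Eventually.of_forall fun n =>
      subset_closure (Set.mem_range_self n))))
  -- Convergence along an ultrafilter suffices: for Hölder `w` the full sequence already converges,
  -- so the limit along `U` only identifies the constant.
  obtain ⟨U, hU, hUμ⟩ := mapClusterPt_iff_ultrafilter.1 hμ
  rw [ProbabilityMeasure.tendsto_iff_forall_integral_tendsto] at hUμ
  have hlim : ∀ φ : RSeq →ᵇ ℝ,
      Tendsto (fun n => (ruelleCLM ℝ ν A ^ n) φ x) U (𝓝 (∫ y, φ y ∂(μ : Measure RSeq))) :=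
    fun φ => (hUμ φ).congr fun n => by
      change ∫ y, φ y ∂((dualRuelle ν A)^[n] (Measure.dirac x)) = _
      rw [integral_iterate_dualRuelle h1, integral_dirac]
  refine ⟨μ, inferInstance, fun w hw => ?_, fun φ hφ => ?_⟩
  · obtain ⟨C, hC0, hC⟩ := hA.exists_nonneg
    obtain ⟨c, hc⟩ := exists_tendsto_pow_const hβ hC0 hC h1 hw
    have h2 : Tendsto (fun n => (ruelleCLM ℝ ν A ^ n) w x) U (𝓝 c) := by
      have := (((continuous_eval_const x).tendsto (c • (1 : RSeq →ᵇ ℝ))).comp hc).mono_left hU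
      simpa using! this
    rwa [tendsto_nhds_unique (hlim w) h2]
  -- No Hölder regularity is needed here: the sequence of values at `x` is constantly `φ x`.
  · have h2 : ∀ n, (ruelleCLM ℝ ν A ^ n) φ = φ := fun n => by
      induction n with
      | zero => simp
      | succ n ih => rw [pow_succ, mul_apply_eq_comp, hφ, ih]
    have h3 := hlim φ
    simp only [h2] at h3
    exact tendsto_nhds_unique tendsto_const_nhds h3

/-- The Gibbs state of a normalized Hölder potential. -/
theorem exists_gibbs {β : ℝ} (hβ : 0 < β) (hβ1 : β ≤ 1) (hA : IsHolder β A)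
    (h1 : ruelleCLM ℝ ν A 1 = 1) :
    ∃ μ : Measure RSeq, IsProbabilityMeasure μ ∧ MeasurePreserving seqShift μ μ ∧
      (∀ φ : RSeq →ᵇ ℝ, ∫ x, φ x ∂μ = ∫ x, ruelleCLM ℝ ν A φ x ∂μ) ∧
      (∀ μ' : Measure RSeq, IsProbabilityMeasure μ' →
        (∀ φ : RSeq →ᵇ ℝ, ∫ x, φ x ∂μ' = ∫ x, ruelleCLM ℝ ν A φ x ∂μ') → μ' = μ) ∧
      (∀ w : RSeq →ᵇ ℝ, IsHolder β w →
        Tendsto (fun n => (ruelleCLM ℝ ν A ^ n) w) atTop (𝓝 ((∫ y, w y ∂μ) • 1))) ∧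
      ∀ φ : RSeq →ᵇ ℝ, ruelleCLM ℝ ν A φ = φ → ∀ x, φ x = ∫ y, φ y ∂μ := by
  obtain ⟨μ, hμ, hconv, -⟩ := exists_limit_measure hβ hA h1 0
  have hint : ∀ m : Measure RSeq, IsProbabilityMeasure m → ∀ w : RSeq →ᵇ ℝ, IsHolder β w →
      Tendsto (fun n => ∫ x, (ruelleCLM ℝ ν A ^ n) w x ∂m) atTop (𝓝 (∫ y, w y ∂μ)) := by
    intro m hm w hw
    have hz := tendsto_iff_norm_sub_tendsto_zero.1 (hconv w hw)
    refine tendsto_iff_norm_sub_tendsto_zero.2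
      (squeeze_zero (fun _ => norm_nonneg _) (fun n => ?_) hz)
    refine le_trans (le_of_eq ?_) (BoundedContinuousFunction.norm_integral_le_norm m
      ((ruelleCLM ℝ ν A ^ n) w - (∫ y, w y ∂μ) • 1))
    simp only [BoundedContinuousFunction.coe_sub, Pi.sub_apply]
    rw [integral_sub (BoundedContinuousFunction.integrable m _)
      (BoundedContinuousFunction.integrable m _)]
    simp
  have huniq : ∀ m : Measure RSeq, IsProbabilityMeasure m →
      (∀ φ : RSeq →ᵇ ℝ, ∫ x, φ x ∂m = ∫ x, ruelleCLM ℝ ν A φ x ∂m) → m = μ := fun m hm h => by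
    refine measure_ext_of_isHolder hβ hβ1 fun w hw => ?_
    have h2 : ∀ n, ∫ x, (ruelleCLM ℝ ν A ^ n) w x ∂m = ∫ x, w x ∂m := fun n => by
      induction n with
      | zero => simp
      | succ n ih => rw [pow_succ', mul_apply_eq_comp, ← h, ih]
    have h3 := hint m hm w hw
    simp only [h2] at h3
    exact tendsto_nhds_unique tendsto_const_nhds h3
  -- For Hölder `w` the function `L w` is Hölder too, and the iterates of `w` and `L w` have the
  -- same limit.
  have hdual : dualRuelle ν A μ = μ := by
    refine measure_ext_of_isHolder hβ hβ1 fun w hw => ?_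
    rw [integral_dualRuelle]
    have h2 := hint μ hμ _ (hA.ruelleCLM (ν := ν) hβ hw)
    have h3 := (hint μ hμ w hw).comp (tendsto_add_atTop_nat 1)
    refine tendsto_nhds_unique h2 (h3.congr fun n => ?_)
    rw [Function.comp_apply, pow_succ, mul_apply_eq_comp]
  refine ⟨μ, hμ, ⟨continuous_seqShift.measurable, ?_⟩, fun φ => ?_, huniq, hconv,
    fun φ hφ x => ?_⟩
  · have := map_seqShift_dualRuelle (ν := ν) h1 μ
    rwa [hdual] at this
  · rw [← integral_dualRuelle, hdual]
  -- The limit measure started at `x` yields the same constants as `μ`, hence equals `μ`.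
  · obtain ⟨μ', hμ', hconv', hinv⟩ := exists_limit_measure hβ hA h1 x
    have : μ' = μ := measure_ext_of_isHolder hβ hβ1 fun w hw => by
      have := tendsto_nhds_unique (hconv' w hw) (hconv w hw)
      have := DFunLike.congr_fun this 0
      simpa using this
    rw [hinv φ hφ, this]

end Gibbs

/-! ### Spectral lemmas -/

section Spectral

variable {𝕜 E : Type*} [RCLike 𝕜] [NormedAddCommGroup E] [NormedSpace 𝕜 E]

/-- If the powers of `T` grow at most like `lam ^ n`, generalized eigenvectors for `lam` are
eigenvectors. -/
lemma apply_eq_of_mem_maxGenEigenspace {T : E →L[𝕜] E} {lam C : ℝ} (hlam : 0 < lam)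
    (hT : ∀ n φ, ‖(T ^ n) φ‖ ≤ C * lam ^ n * ‖φ‖) {φ : E}
    (hφ : φ ∈ Module.End.maxGenEigenspace T.toLinearMap (lam : 𝕜)) : T φ = (lam : 𝕜) • φ := by
  have hl : ‖(lam : 𝕜)‖ = lam := by rw [RCLike.norm_ofReal, abs_of_pos hlam]
  have two : ∀ φ χ : E, T φ = (lam : 𝕜) • φ + χ → T χ = (lam : 𝕜) • χ → χ = 0 := by
    intro φ χ h1 h2
    -- A Jordan chain of length two would grow like `n * lam ^ (n - 1)`, against `hT`. At `n = 0`
    -- the truncated exponent is harmless because its coefficient vanishes.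
    have hn : ∀ n : ℕ, (T ^ n) φ = (lam : 𝕜) ^ n • φ + (n * (lam : 𝕜) ^ (n - 1)) • χ := fun n => by
      induction n with
      | zero => simp
      | succ n ih =>
        rw [pow_succ', mul_apply_eq_comp, ih, map_add, map_smul, map_smul, h1, h2]
        cases n with
        | zero => simp
        | succ n =>
          simp only [Nat.add_sub_cancel]
          push_cast
          module
    have hb : ∀ n : ℕ, (n : ℝ) * ‖χ‖ ≤ lam * ((C + 1) * ‖φ‖) := fun n => by
      cases n with
      | zero =>
        have h0 := hT 0 φ
        simp only [pow_zero, one_apply_eq_self, mul_one] at h0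
        simp only [Nat.cast_zero, zero_mul]
        have := norm_nonneg φ
        have h3 : 0 ≤ (C + 1) * ‖φ‖ := by linarith
        positivity
      | succ n =>
        have h3 : (((n + 1 : ℕ) : 𝕜) * (lam : 𝕜) ^ n) • χ =
            (T ^ (n + 1)) φ - (lam : 𝕜) ^ (n + 1) • φ := by
          rw [hn, Nat.add_sub_cancel]; abel
        have h4 := norm_sub_le ((T ^ (n + 1)) φ) ((lam : 𝕜) ^ (n + 1) • φ)
        rw [← h3, norm_smul, norm_smul, norm_mul, norm_pow, norm_pow, hl, RCLike.norm_natCast] at h4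
        have h5 := hT (n + 1) φ
        have hp : 0 < lam ^ n := pow_pos hlam n
        rw [pow_succ lam n] at h4 h5
        refine le_of_mul_le_mul_left ?_ hp
        nlinarith
    by_contra hχ
    have hχ0 : 0 < ‖χ‖ := norm_pos_iff.2 hχ
    obtain ⟨n, hn⟩ := exists_nat_gt (lam * ((C + 1) * ‖φ‖) / ‖χ‖)
    rw [div_lt_iff₀ hχ0] at hn
    exact absurd (hb n) (not_le.2 hn)
  obtain ⟨k, hk⟩ := (Module.End.mem_maxGenEigenspace _ _ _).1 hφ
  set N : Module.End 𝕜 E := T.toLinearMap - (lam : 𝕜) • (1 : Module.End 𝕜 E) with hN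
  have hNa : ∀ x, T x = (lam : 𝕜) • x + N x := fun x => by simp [hN]
  have step : ∀ x, N (N x) = 0 → N x = 0 := fun x hx =>
    two x (N x) (hNa x) (by rw [hNa, hx, add_zero])
  have : ∀ k : ℕ, (N ^ (k + 1)) φ = 0 → N φ = 0 := fun k => by
    induction k with
    | zero => simp
    | succ k ih =>
      intro h
      refine ih ?_
      rw [pow_succ', Module.End.mul_apply]
      refine step _ ?_
      rwa [pow_succ', pow_succ', Module.End.mul_apply, Module.End.mul_apply] at h
  have h0 : N φ = 0 := by
    refine this k ?_
    rw [pow_succ', Module.End.mul_apply, hk, map_zero]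
  rw [hNa, h0, add_zero]

/-- If `k` is in the spectrum then `k ^ n` is in that of `T ^ n`, so `‖k‖ ^ n` is at most a constant
times `lam ^ n`, forcing `‖k‖ ≤ lam`. The eigenvector gives equality. -/
lemma spectralRadius_eq_of_eigenvector [CompleteSpace E] {T : E →L[𝕜] E} {lam C : ℝ}
    (hlam : 0 < lam) (hT : ∀ n φ, ‖(T ^ n) φ‖ ≤ C * lam ^ n * ‖φ‖) {φ : E} (hφ0 : φ ≠ 0)
    (hφ : T φ = (lam : 𝕜) • φ) : spectralRadius 𝕜 T = ENNReal.ofReal lam := by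
  refine le_antisymm (iSup₂_le fun k hk => ?_) ?_
  · have hpow : ∀ n : ℕ, ‖k‖ ^ n ≤ |C| * ‖(1 : E →L[𝕜] E)‖ * lam ^ n := fun n => by
      have h1 : k ^ n ∈ spectrum 𝕜 (T ^ n) := spectrum.pow_mem_pow T n hk
      have h2 := spectrum.norm_le_norm_mul_of_mem h1
      rw [norm_pow] at h2
      have h3 : ‖T ^ n‖ ≤ |C| * lam ^ n :=
        ContinuousLinearMap.opNorm_le_bound _ (by positivity) fun φ => (hT n φ).trans (by
          gcongr
          exact le_abs_self C)
      calc ‖k‖ ^ n ≤ ‖T ^ n‖ * ‖(1 : E →L[𝕜] E)‖ := h2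
        _ ≤ |C| * lam ^ n * ‖(1 : E →L[𝕜] E)‖ := by gcongr
        _ = _ := by ring
    have hk' : ‖k‖ ≤ lam := by
      by_contra! hlt
      have h1 : 1 < ‖k‖ / lam := (one_lt_div hlam).2 hlt
      obtain ⟨n, hn⟩ := pow_unbounded_of_one_lt (|C| * ‖(1 : E →L[𝕜] E)‖) h1
      rw [div_pow, lt_div_iff₀ (pow_pos hlam n)] at hn
      exact absurd (hpow n) (not_le.2 hn)
    rw [← enorm_eq_nnnorm, ← ofReal_norm]
    exact ENNReal.ofReal_le_ofReal hk'
  · have hmem : (lam : 𝕜) ∈ spectrum 𝕜 T := by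
      intro hu
      have h0 : (algebraMap 𝕜 (E →L[𝕜] E) (lam : 𝕜) - T) φ = 0 := by
        simp [hφ, Algebra.algebraMap_eq_smul_one]
      obtain ⟨u, hu⟩ := hu
      apply hφ0
      calc φ = (↑u⁻¹ * (u : E →L[𝕜] E)) φ := by simp
        _ = 0 := by rw [mul_apply_eq_comp, hu, h0, map_zero]
    have h1 : ENNReal.ofReal lam = (‖(lam : 𝕜)‖₊ : ENNReal) := by
      rw [← enorm_eq_nnnorm, ← ofReal_norm, RCLike.norm_ofReal, abs_of_pos hlam]
    rw [h1]
    exact le_iSup₂ (f := fun k (_ : k ∈ spectrum 𝕜 T) => (‖k‖₊ : ENNReal)) _ hmem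

end Spectral

/-! ### Normalization -/

section Normalization

variable {ν : Measure ℝ} [IsProbabilityMeasure ν] {A : RSeq →ᵇ ℝ} {ψ : RSeq → ℝ} {lam m : ℝ}

lemma coe_ruelleCLM_pow (φ : RSeq →ᵇ ℝ) (n : ℕ) :
    ⇑((ruelleCLM ℝ ν A ^ n) φ) = (ruelle ν A)^[n] φ := by
  induction n with
  | zero => rfl
  | succ n ih =>
    rw [pow_succ', mul_apply_eq_comp, Function.iterate_succ_apply', ← ih]
    rfl

/-- At `ax` the term `ψ ∘ σ` equals `ψ x` and leaves the integral, so the coboundary acts as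
conjugation by `ψ`. -/
lemma ruelle_normalizedPotential (ν : Measure ℝ) (A : RSeq → ℝ) (hlam : 0 < lam)
    (hψ : ∀ x, 0 < ψ x) (φ : RSeq → ℝ) (x : RSeq) :
    ruelle ν (normalizedPotential A ψ lam) φ x =
      (lam * ψ x)⁻¹ * ruelle ν A (fun y => ψ y * φ y) x := by
  rw [ruelle, ruelle, ← integral_const_mul]
  refine integral_congr_ae (ae_of_all _ fun a => ?_)
  simp only [normalizedPotential, seqShift_seqCons, smul_eq_mul]
  rw [Real.exp_sub, Real.exp_sub, Real.exp_add, Real.exp_log (hψ _), Real.exp_log (hψ _),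
    Real.exp_log hlam]
  have := (hψ x).ne'
  field_simp

lemma ruelle_const_mul (ν : Measure ℝ) (A : RSeq → ℝ) (c : ℝ) (φ : RSeq → ℝ) :
    ruelle ν A (fun y => c * φ y) = fun x => c * ruelle ν A φ x := by
  funext x
  rw [ruelle, ruelle, ← integral_const_mul]
  simp only [smul_eq_mul, mul_left_comm]

lemma iterate_ruelle_normalizedPotential (ν : Measure ℝ) (A : RSeq → ℝ) (hlam : 0 < lam)
    (hψ : ∀ x, 0 < ψ x) (φ : RSeq → ℝ) (n : ℕ) (x : RSeq) :
    (ruelle ν A)^[n] (fun y => ψ y * φ y) x =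
      lam ^ n * (ψ x * (ruelle ν (normalizedPotential A ψ lam))^[n] φ x) := by
  induction n generalizing x with
  | zero => simp
  | succ n ih =>
    rw [Function.iterate_succ_apply', Function.iterate_succ_apply', funext ih, ruelle_const_mul,
      ruelle_normalizedPotential ν A hlam hψ]
    have := (hψ x).ne'
    field_simp
    ring

/-- The domination `‖φ‖ ≤ const * ψ` holds pointwise since `m ≤ ψ`, and each application of `L`
multiplies the dominating function by `lam`. -/
lemma norm_ruelleCLM_pow_le {𝕜 : Type*} [RCLike 𝕜] (hlam : 0 < lam) (hm : 0 < m)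
    {ψ : RSeq →ᵇ ℝ} (hmψ : ∀ x, m ≤ ψ x) (heig : ∀ x, ruelle ν A ψ x = lam * ψ x)
    (n : ℕ) (φ : RSeq →ᵇ 𝕜) :
    ‖(ruelleCLM 𝕜 ν A ^ n) φ‖ ≤ ‖ψ‖ / m * lam ^ n * ‖φ‖ := by
  have h0 : ∀ n x, ‖(ruelleCLM 𝕜 ν A ^ n) φ x‖ ≤ ‖φ‖ / m * lam ^ n * ψ x := by
    intro n
    induction n with
    | zero =>
      intro x
      simp only [pow_zero, mul_one, one_apply_eq_self]
      calc ‖φ x‖ ≤ ‖φ‖ := φ.norm_coe_le_norm x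
        _ = ‖φ‖ / m * m := by field_simp
        _ ≤ ‖φ‖ / m * ψ x := by gcongr; exact hmψ x
    | succ n ih =>
      intro x
      rw [pow_succ', mul_apply_eq_comp, ruelleCLM_apply]
      calc _ ≤ ∫ a, (‖φ‖ / m * lam ^ n) * (Real.exp (A (seqCons a x)) • ψ (seqCons a x)) ∂ν := by
            refine norm_integral_le_of_norm_le
              ((integrable_ruelle_integrand ν A ψ x).const_mul _) (ae_of_all _ fun a => ?_)
            rw [norm_smul, Real.norm_of_nonneg (Real.exp_pos _).le, smul_eq_mul, mul_left_comm]
            exact mul_le_mul_of_nonneg_left (ih _) (Real.exp_pos _).le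
        _ = (‖φ‖ / m * lam ^ n) * ruelle ν A ψ x := integral_const_mul _ _
        _ = _ := by rw [heig, pow_succ]; ring
  refine (BoundedContinuousFunction.norm_le (by positivity)).2 fun x => (h0 n x).trans ?_
  calc _ ≤ ‖φ‖ / m * lam ^ n * ‖ψ‖ := by
        gcongr
        exact (le_abs_self _).trans (ψ.norm_coe_le_norm x)
    _ = _ := by ring

lemma ruelle_clm_comp {𝕜 : Type*} [RCLike 𝕜] (r : 𝕜 →L[ℝ] ℝ) (φ : RSeq →ᵇ 𝕜) (x : RSeq) :
    ruelle ν A (fun y => r (φ y)) x = r (ruelle ν A φ x) := by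
  rw [ruelle, ruelle, ← r.integral_comp_comm (integrable_ruelle_integrand ν A φ x)]
  simp only [map_smul]

/-- Simplicity of the eigenvalue, given that the fixed points of the normalized operator are
constant. -/
lemma finrank_maxGenEigenspace_eq_one (𝕜 : Type*) [RCLike 𝕜] (hlam : 0 < lam) (hm : 0 < m)
    {ψ : RSeq →ᵇ ℝ} (hmψ : ∀ x, m ≤ ψ x) (heig : ∀ x, ruelle ν A ψ x = lam * ψ x)
    (hconst : ∀ φ : RSeq →ᵇ ℝ, (∀ x, ruelle ν A φ x = lam * φ x) → ∃ c : ℝ, ∀ x, φ x = c * ψ x) :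
    Module.finrank 𝕜 (Module.End.maxGenEigenspace (ruelleCLM 𝕜 ν A).toLinearMap (lam : 𝕜)) = 1 ∧
      ∃ φ : RSeq →ᵇ 𝕜, φ ≠ 0 ∧ ruelleCLM 𝕜 ν A φ = (lam : 𝕜) • φ := by
  let Ψ : RSeq →ᵇ 𝕜 := RCLike.ofRealCLM.compLeftContinuousBounded RSeq ψ
  have hΨ : ∀ x, Ψ x = (ψ x : 𝕜) := fun x => rfl
  have hΨ0 : Ψ ≠ 0 := fun h => by
    have h1 := DFunLike.congr_fun h 0
    rw [hΨ, BoundedContinuousFunction.coe_zero, Pi.zero_apply, RCLike.ofReal_eq_zero] at h1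
    exact (hm.trans_le (hmψ 0)).ne' h1
  have hΨe : ruelleCLM 𝕜 ν A Ψ = (lam : 𝕜) • Ψ := by
    ext x
    have h1 : ruelle ν A Ψ x = ((ruelle ν A ψ x : ℝ) : 𝕜) := by
      rw [ruelle, ruelle, ← integral_ofReal]
      simp only [hΨ, RCLike.real_smul_eq_coe_mul, smul_eq_mul, RCLike.ofReal_mul]
    rw [ruelleCLM_apply, h1, heig]
    simp [hΨ]
  refine ⟨?_, Ψ, hΨ0, hΨe⟩
  have hmem : Ψ ∈ Module.End.maxGenEigenspace (ruelleCLM 𝕜 ν A).toLinearMap (lam : 𝕜) :=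
    Module.End.eigenspace_le_maxGenEigenspace (Module.End.mem_eigenspace_iff.2 hΨe)
  refine (finrank_eq_one_iff_of_nonzero' (⟨Ψ, hmem⟩ : Module.End.maxGenEigenspace
    (ruelleCLM 𝕜 ν A).toLinearMap (lam : 𝕜)) (fun h => hΨ0 (congrArg Subtype.val h))).2 ?_
  rintro ⟨φ, hφ⟩
  have hφe := apply_eq_of_mem_maxGenEigenspace hlam
    (norm_ruelleCLM_pow_le (𝕜 := 𝕜) hlam hm hmψ heig) hφ
  -- The kernel and `lam` are real, so real and imaginary parts of an eigenfunction are real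
  -- eigenfunctions.
  have hr : ∀ r : 𝕜 →L[ℝ] ℝ, ∃ c : ℝ, ∀ x, r (φ x) = c * ψ x := fun r => by
    refine hconst (r.compLeftContinuousBounded RSeq φ) fun x => ?_
    refine (ruelle_clm_comp r φ x).trans ?_
    rw [← ruelleCLM_apply, hφe]
    change r ((lam : 𝕜) * φ x) = lam * r (φ x)
    rw [← RCLike.real_smul_eq_coe_mul, map_smul, smul_eq_mul]
  obtain ⟨c, hc⟩ := hr RCLike.reCLM
  obtain ⟨d, hd⟩ := hr RCLike.imCLM
  refine ⟨(c : 𝕜) + d * RCLike.I, Subtype.ext ?_⟩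
  ext x
  change ((c : 𝕜) + d * RCLike.I) * (ψ x : 𝕜) = φ x
  have h1 : RCLike.re (φ x) = c * ψ x := hc x
  have h2 : RCLike.im (φ x) = d * ψ x := hd x
  rw [← RCLike.re_add_im (φ x), h1, h2]
  push_cast
  ring

end Normalization

/-! ### The main theorem -/

lemma integral_withDensity_ofReal_one_div {μ : Measure RSeq} {ψ : RSeq → ℝ} (hψ : ∀ x, 0 < ψ x)
    (hψc : Continuous ψ) (g : RSeq → ℝ) :
    ∫ x, g x ∂(μ.withDensity fun x => ENNReal.ofReal (1 / ψ x)) = ∫ x, g x * (ψ x)⁻¹ ∂μ := by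
  simp only [ENNReal.ofReal]
  rw [integral_withDensity_eq_integral_smul]
  · refine integral_congr_ae (ae_of_all _ fun x => ?_)
    simp only [NNReal.smul_def, smul_eq_mul]
    rw [Real.coe_toNNReal _ (one_div_pos.2 (hψ x)).le, one_div, mul_comm]
  · exact (continuous_const.div hψc fun x => (hψ x).ne').measurable.real_toNNReal

lemma isProbabilityMeasure_withDensity_one_div {μ : Measure RSeq} {ψ : RSeq → ℝ}
    (hψ : ∀ x, 0 < ψ x) (hint : Integrable (fun x => (ψ x)⁻¹) μ) (h1 : ∫ x, (ψ x)⁻¹ ∂μ = 1) :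
    IsProbabilityMeasure (μ.withDensity fun x => ENNReal.ofReal (1 / ψ x)) := by
  constructor
  rw [withDensity_apply _ MeasurableSet.univ, Measure.restrict_univ]
  simp only [one_div]
  rw [← ofReal_integral_eq_lintegral_ofReal hint (ae_of_all _ fun x => (inv_pos.2 (hψ x)).le), h1,
    ENNReal.ofReal_one]

lemma normalizedPotential_const_mul (A : RSeq → ℝ) {ψ : RSeq → ℝ} (hψ : ∀ x, 0 < ψ x) (lam : ℝ)
    {c : ℝ} (hc : 0 < c) :
    normalizedPotential A (fun x => c * ψ x) lam = normalizedPotential A ψ lam := by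
  funext x
  simp only [normalizedPotential]
  rw [Real.log_mul hc.ne' (hψ _).ne', Real.log_mul hc.ne' (hψ _).ne']
  ring

/-- An eigenfunction can be scaled so that its inverse has integral one against the Gibbs state of
the normalized potential. -/
lemma exists_normalized_eigenfunction {ν : Measure ℝ} [IsProbabilityMeasure ν] {α : ℝ}
    (hα : 0 < α) {A : RSeq → ℝ} (hA : IsHolder α A) :
    ∃ (lam : ℝ) (ψ : RSeq →ᵇ ℝ) (m : ℝ) (μ : Measure RSeq), 0 < lam ∧ 0 < m ∧ (∀ x, m ≤ ψ x) ∧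
      IsHolder α ψ ∧ (∀ x, ruelle ν A ψ x = lam * ψ x) ∧ IsProbabilityMeasure μ ∧
      MeasurePreserving seqShift μ μ ∧
      IsRuelleDual ν (normalizedPotential A ψ lam) μ μ ∧
      (∀ μ' : Measure RSeq, IsProbabilityMeasure μ' →
        IsRuelleDual ν (normalizedPotential A ψ lam) μ' μ' → μ' = μ) ∧
      (∀ w : RSeq → ℝ, IsHolder α w → TendstoUniformly
        (fun (n : ℕ) x => (ruelle ν (normalizedPotential A ψ lam))^[n] w x)
        (fun _ => ∫ y, w y ∂μ) atTop) ∧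
      (∀ φ : RSeq →ᵇ ℝ, (∀ x, ruelle ν (normalizedPotential A ψ lam) φ x = φ x) →
        ∀ x, φ x = ∫ y, φ y ∂μ) ∧
      ∫ x, (ψ x)⁻¹ ∂μ = 1 := by
  obtain ⟨C, hC0, hC⟩ := hA.exists_nonneg
  obtain ⟨lam, ψ, m, hlam, hm, hmψ, hψ, heig⟩ :=
    exists_eigenfunction (ν := ν) (A := hA.toBCF hα) hα hC0 hC
  have hpos : ∀ x, 0 < ψ x := fun x => hm.trans_le (hmψ x)
  have heig' : ∀ x, ruelle ν A ψ x = lam * ψ x := fun x => DFunLike.congr_fun heig x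
  have hB := hA.normalizedPotential hα hψ hm hmψ lam
  set B := hB.toBCF hα with hBdef
  have hBc : ⇑B = normalizedPotential A ψ lam := rfl
  have h1 : ruelleCLM ℝ ν B 1 = 1 := by
    ext x
    rw [ruelleCLM_apply, hBc, ruelle_normalizedPotential ν A hlam hpos]
    simp only [BoundedContinuousFunction.coe_one, Pi.one_apply, mul_one]
    rw [heig', inv_mul_cancel₀ (mul_pos hlam (hpos x)).ne']
  -- The exponent is lowered to at most one so that Hölder functions determine measures; `α`-Hölder
  -- functions remain admissible because the diameter is at most one.
  have hβ : 0 < min α 1 := lt_min hα one_pos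
  have hBβ : IsHolder (min α 1) B := hB.mono_exponent hβ (min_le_left _ _)
  obtain ⟨μ, hμ, hshift, hdual, huniq, hconv, hinv⟩ :=
    exists_gibbs (ν := ν) hβ (min_le_right _ _) hBβ h1
  have hψi := hψ.inv hm hmψ
  -- Replacing `ψ` by `c • ψ` makes the integral of the inverse equal to one; the normalized
  -- potential, and hence `μ`, does not change.
  set c := ∫ x, (ψ x)⁻¹ ∂μ with hc
  have hc0 : 0 < c := by
    refine integral_pos_iff_support_of_nonneg (fun x => (inv_pos.2 (hpos x)).le)
      ((hψi.toBCF hα).integrable μ) |>.2 ?_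
    have : (Function.support fun x => (ψ x)⁻¹) = Set.univ :=
      Set.eq_univ_of_forall fun x => (inv_pos.2 (hpos x)).ne'
    rw [this, measure_univ]
    exact one_pos
  have hcψ : ⇑(c • ψ) = fun x => c * ψ x := rfl
  refine ⟨lam, c • ψ, c * m, μ, hlam, mul_pos hc0 hm,
    fun x => mul_le_mul_of_nonneg_left (hmψ x) hc0.le, hψ.const_mul c, fun x => ?_, hμ, hshift, ?_⟩
  · rw [hcψ, ruelle_const_mul]
    simp only [heig']
    ring
  rw [hcψ, normalizedPotential_const_mul A hpos lam hc0, ← hBc]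
  refine ⟨hdual, huniq, fun w hw => ?_, fun φ hφ => hinv φ (BoundedContinuousFunction.ext hφ), ?_⟩
  · have h2 := hconv (hw.toBCF hα) (hw.mono_exponent hβ (min_le_left _ _))
    rw [BoundedContinuousFunction.tendsto_iff_tendstoUniformly] at h2
    simp only [coe_ruelleCLM_pow] at h2
    simpa [Function.const] using! h2
  · simp only [mul_inv]
    rw [integral_const_mul, ← hc, inv_mul_cancel₀ hc0.ne']

theorem mainTheorem1 (f : PosDensity) (α : ℝ) (hα : 0 < α) (A : RSeq → ℝ) (hA : IsHolder α A) :
    ∃ (lam : ℝ) (ψ : RSeq → ℝ) (μ ρ : Measure RSeq),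
      -- positive eigenvalue with a strictly positive Hölder eigenfunction
      (0 < lam ∧ (∀ x, 0 < ψ x) ∧ IsHolder α ψ ∧
        ∀ x, ruelle f.measure A ψ x = lam * ψ x) ∧
      -- the eigenvalue is simple and leading on bounded continuous functions
      (Module.finrank ℝ (Module.End.maxGenEigenspace
          (ruelleCLM ℝ f.measure (hA.toBCF hα)).toLinearMap lam) = 1 ∧
        Module.finrank ℂ (Module.End.maxGenEigenspace
          (ruelleCLM ℂ f.measure (hA.toBCF hα)).toLinearMap (lam : ℂ)) = 1 ∧
        spectralRadius ℂ (ruelleCLM ℂ f.measure (hA.toBCF hα)) = ENNReal.ofReal lam) ∧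
      -- the Gibbs state
      (IsHolder α (normalizedPotential A ψ lam) ∧
        IsProbabilityMeasure μ ∧ MeasurePreserving seqShift μ μ ∧
        IsRuelleDual f.measure (normalizedPotential A ψ lam) μ μ ∧
        ∀ μ' : Measure RSeq, IsProbabilityMeasure μ' →
          IsRuelleDual f.measure (normalizedPotential A ψ lam) μ' μ' → μ' = μ) ∧
      -- the conformal measure
      (ρ = μ.withDensity (fun x => ENNReal.ofReal (1 / ψ x)) ∧
        IsProbabilityMeasure ρ ∧
        IsRuelleDual f.measure A ρ (ENNReal.ofReal lam • ρ)) ∧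
      -- uniform convergence of the iterates
      ∀ w : RSeq → ℝ, IsHolder α w →
        TendstoUniformly
          (fun (n : ℕ) x => (ruelle f.measure (normalizedPotential A ψ lam))^[n] w x)
          (fun _ => ∫ y, w y ∂μ) atTop ∧
        TendstoUniformly
          (fun (n : ℕ) x => (ruelle f.measure A)^[n] w x / lam ^ n)
          (fun x => ψ x * ∫ y, w y ∂ρ) atTop := by
  obtain ⟨lam, ψ, m, μ, hlam, hm, hmψ, hψ, heig, hμ, hshift, hdual, huniq, hconv, hinv, hone⟩ :=
    exists_normalized_eigenfunction (ν := f.measure) hα hA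
  have hpos : ∀ x, 0 < ψ x := fun x => hm.trans_le (hmψ x)
  have hψi := hψ.inv hm hmψ
  have hconst : ∀ φ : RSeq →ᵇ ℝ, (∀ x, ruelle f.measure (hA.toBCF hα) φ x = lam * φ x) →
      ∃ c : ℝ, ∀ x, φ x = c * ψ x := fun φ hφ => by
    -- By conjugation, `φ / ψ` is fixed by the normalized operator, hence constant.
    have h := hinv (φ * hψi.toBCF hα) fun x => by
      rw [ruelle_normalizedPotential f.measure A hlam hpos]
      have : (fun y => ψ y * (φ * hψi.toBCF hα) y) = φ := by
        funext y
        have := (hpos y).ne'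
        simp only [BoundedContinuousFunction.coe_mul, Pi.mul_apply, IsHolder.toBCF_apply]
        field_simp
      rw [this, show ruelle f.measure A φ x = lam * φ x from hφ x]
      have := (hpos x).ne'
      simp only [BoundedContinuousFunction.coe_mul, Pi.mul_apply, IsHolder.toBCF_apply]
      field_simp
    refine ⟨∫ y, (φ * hψi.toBCF hα) y ∂μ, fun x => ?_⟩
    rw [← h x]
    have := (hpos x).ne'
    simp only [BoundedContinuousFunction.coe_mul, Pi.mul_apply, IsHolder.toBCF_apply]
    field_simp
  have heig' : ∀ x, ruelle f.measure (hA.toBCF hα) ψ x = lam * ψ x := heig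
  obtain ⟨hfinC, φ, hφ0, hφ⟩ := finrank_maxGenEigenspace_eq_one ℂ hlam hm hmψ heig' hconst
  refine ⟨lam, ψ, μ, μ.withDensity fun x => ENNReal.ofReal (1 / ψ x), ⟨hlam, hpos, hψ, heig⟩,
    ⟨(finrank_maxGenEigenspace_eq_one ℝ hlam hm hmψ heig' hconst).1, hfinC,
      spectralRadius_eq_of_eigenvector hlam
        (norm_ruelleCLM_pow_le (𝕜 := ℂ) hlam hm hmψ heig') hφ0 hφ⟩,
    ⟨hA.normalizedPotential hα hψ hm hmψ lam, hμ, hshift, hdual, huniq⟩,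
    ⟨rfl, isProbabilityMeasure_withDensity_one_div hpos ((hψi.toBCF hα).integrable μ) hone,
      fun φ => ?_⟩, fun w hw => ⟨hconv w hw, ?_⟩⟩
  · rw [integral_smul_measure, ENNReal.toReal_ofReal hlam.le,
      integral_withDensity_ofReal_one_div hpos ψ.continuous,
      integral_withDensity_ofReal_one_div hpos ψ.continuous, smul_eq_mul, ← integral_const_mul]
    -- Invariance of `μ` is tested on `φ / ψ`, whose image under the normalized operator is `L φ /
    -- (lam * ψ)`.
    have h := hdual (φ * hψi.toBCF hα)
    simp only [BoundedContinuousFunction.coe_mul, Pi.mul_apply, IsHolder.toBCF_apply] at h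
    rw [integral_const_mul, h, ← integral_const_mul]
    refine integral_congr_ae (ae_of_all _ fun x => ?_)
    have h2 := ruelle_normalizedPotential f.measure A hlam hpos (⇑φ * ⇑(hψi.toBCF hα)) x
    have h3 : (fun y => ψ y * (⇑φ * ⇑(hψi.toBCF hα)) y) = φ := by
      funext y
      have := (hpos y).ne'
      simp only [Pi.mul_apply, IsHolder.toBCF_apply]
      field_simp
    rw [h3] at h2
    simp only [h2]
    have := (hpos x).ne'
    field_simp
  · rw [integral_withDensity_ofReal_one_div hpos ψ.continuous]
    -- The normalized convergence is applied to `w / ψ` and multiplied by `ψ`; boundedness of `ψ`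
    -- keeps it uniform.
    have hu := hconv _ (hw.mul hα hψi)
    rw [Metric.tendstoUniformly_iff] at hu ⊢
    intro ε hε
    have hψn : 0 < ‖ψ‖ := (hpos 0).trans_le ((le_abs_self _).trans (ψ.norm_coe_le_norm 0))
    filter_upwards [hu (ε / ‖ψ‖) (div_pos hε hψn)] with n hn x
    have e : (ruelle f.measure A)^[n] w x / lam ^ n =
        ψ x * (ruelle f.measure (normalizedPotential A ψ lam))^[n] (fun y => w y * (ψ y)⁻¹) x := by
      have h := iterate_ruelle_normalizedPotential f.measure A hlam hpos
        (fun y => w y * (ψ y)⁻¹) n x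
      have h3 : (fun y => ψ y * (w y * (ψ y)⁻¹)) = w := by
        funext y
        have := (hpos y).ne'
        field_simp
      rw [h3] at h
      rw [h, mul_div_cancel_left₀ _ (pow_pos hlam n).ne']
    have hnx := hn x
    rw [Real.dist_eq] at hnx ⊢
    rw [e, ← mul_sub, abs_mul, abs_of_pos (hpos x)]
    calc _ ≤ ‖ψ‖ * |_| := mul_le_mul_of_nonneg_right
          ((le_abs_self _).trans (ψ.norm_coe_le_norm x)) (abs_nonneg _)
      _ < ‖ψ‖ * (ε / ‖ψ‖) := mul_lt_mul_of_pos_left hnx hψn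
      _ = ε := by field_simp
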